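/- Let $\Bbbk$ be $\mathbb{R}$ or $\mathbb{C}$. **Conventions.** An *affine algebraic Lie groupoid* $\mathcal{G}\rightrightarrows X$ is a groupoid object in affine varieties over $\Bbbk$ (reduced affine schemes of finite type) with $\mathcal{G}$, $X$ smooth and source and target morphisms $\mathsf{s},\mathsf{t}:\mathcal{G}\to X$ smooth; write $\mathsf{1}:X\to\mathcal{G}$ for the identity bisection and $\mathsf{m}:\mathcal{G}\times_{\mathsf{s},\mathsf{t}}\mathcal{G}\to\mathcal{G}$ for multiplication. It is an *affine symplectic groupoid* if $\mathcal{G}$ carries an algebraic symplectic form $\omega$ for which the graph $\Gamma_{\mathsf{m}}=\{(g,h,gh)\}$ is coisotropic in $\mathcal{G}\times\mathcal{G}\times\mathcal{G}^-$, i.e. the ideal of $\Gamma_{\mathsf{m}}$ is closed under the Poisson bracket; here $\mathcal{G}^-$ denotes $\mathcal{G}$ with the form $-\omega$. In this case $X$ has the Poisson bracket for which $\mathsf{t}$ is Poisson; let $\sigma:T^*X\to TX$ be contraction with its Poisson bivector field. The Lie algebroid of $\mathcal{G}$, whose fibre at $x\in X$ is $\ker(d\mathsf{s})\subseteq T_{\mathsf{1}(x)}\mathcal{G}$,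 is identified with $T^*X$ by $v\mapsto\omega(v,d\mathsf{1}(\cdot))$. Let $\mathcal{H}\rightrightarrows S$ be a smooth closed subgroupoid of $\mathcal{G}$ (itself an affine algebraic Lie groupoid) over a smooth closed subvariety $S\subseteq X$. It is called a *stabilizer subgroupoid* if $\mathcal{H}$ is isotropic in $\mathcal{G}$ (the form $\omega$ pulls back to $0$ on $\mathcal{H}$) and, under the above identification, the Lie algebroid of $\mathcal{H}$ is $N^*_SX\cap\sigma^{-1}(TS)$, where $N^*_SX\subseteq T^*X|_S$ is the conormal bundle (equality of fibres at every field-valued point of $S$). **Proposition.** Let $\mathcal{G}\rightrightarrows X$ be an affine symplectic groupoid over $\Bbbk$ with symplectic form $\omega$. Then $\mathcal{G}^-\times\mathcal{G}\rightrightarrows X\times X$, with the product groupoid structure and the symplectic form $-\mathrm{pr}_1^*\omega+\mathrm{pr}_2^*\omega$, is an affine symplectic groupoid, and the diagonal $\Delta\mathcal{G}\rightrightarrows\Delta X$ is a stabilizer subgroupoid of $\mathcal{G}^-\times\mathcal{G}$. -/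

import Mathlib

open scoped TensorProduct KaehlerDifferential

universe u v w

noncomputable section

namespace AffSympl

/-! ### Tangent spaces of affine schemes

Everything is written in terms of coordinate algebras: `A` stands for the affine `k`-scheme
`Spec A`, an algebra morphism `A →ₐ[k] R` for an `R`-valued point of it, and an algebra morphism
`φ : A →ₐ[k] B` for a morphism `Spec B ⟶ Spec A`. -/

section Tangent

variable {k : Type v} [Field k]
variable {A : Type u} [CommRing A] [Algebra k A]
variable {B : Type u} [CommRing B] [Algebra k B]
variable {K : Type u} [CommRing K] [Algebra k K]

/-- The tangent space of `Spec A` at a `K`-point `x`: the `k`-linear maps `v : A → K` with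
`v (f g) = x f * v g + x g * v f`. -/
def tangentSpace (x : A →ₐ[k] K) : Submodule K (A →ₗ[k] K) where
  carrier := {v | ∀ f g : A, v (f * g) = x f * v g + x g * v f}
  zero_mem' := by intro f g; simp
  add_mem' := by
    intro v w hv hw f g
    simp only [LinearMap.add_apply, hv f g, hw f g]
    ring
  smul_mem' := by
    intro c v hv f g
    simp only [LinearMap.smul_apply, hv f g, smul_eq_mul]
    ring

/-- The differential at the `K`-point `y` of the morphism `Spec B ⟶ Spec A` given by `φ`. -/
def tangentMap (φ : A →ₐ[k] B) (y : B →ₐ[k] K) :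
    tangentSpace y →ₗ[K] tangentSpace (y.comp φ) where
  toFun v := ⟨v.1.comp φ.toLinearMap, by
    intro f g
    simpa using v.2 (φ f) (φ g)⟩
  map_add' _ _ := rfl
  map_smul' _ _ := rfl

/-- A tangent vector at `y`, seen as a derivation `B → K`, where `B` acts on `K` through `y`. -/
def tangentDerivation (y : B →ₐ[k] K) (v : tangentSpace y) :
    letI : Algebra B K := y.toAlgebra
    Derivation k B K :=
  letI : Algebra B K := y.toAlgebra
  Derivation.mk' v.1 (fun f g => v.2 f g)

end Tangent

/-! ### Differential 2-forms -/

section Forms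

/-- The alternating map `(α, β) ↦ b (α, β) - b (β, α)` attached to a bilinear map `b`. -/
def alternate {B M N : Type*} [CommRing B] [AddCommGroup M] [Module B M] [AddCommGroup N]
    [Module B N] (b : M →ₗ[B] M →ₗ[B] N) : M [⋀^Fin 2]→ₗ[B] N where
  toFun m := b (m 0) (m 1) - b (m 1) (m 0)
  map_update_add' := by
    intro _ m i x y
    fin_cases i <;> simp <;> abel
  map_update_smul' := by
    intro _ m i c x
    fin_cases i <;> simp [smul_sub]
  map_eq_zero_of_eq' := by
    intro m i j hij hne
    fin_cases i <;> fin_cases j <;> simp_all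

variable (k : Type v) [Field k] (B : Type u) [CommRing B] [Algebra k B]

/-- Algebraic 2-forms on `Spec B`. -/
abbrev TwoForm : Type u := ⋀[B]^2 Ω[B⁄k]

variable {k B}

/-- The pairing `ω(δ, δ')` of a 2-form with two derivations `δ, δ' : B → R`; it is determined by
`(df ∧ dg)(δ, δ') = δ f * δ' g - δ g * δ' f`. -/
def TwoForm.eval {R : Type u} [CommRing R] [Algebra k R] [Algebra B R]
    [IsScalarTower k B R] (ω : TwoForm k B) (δ δ' : Derivation k B R) : R :=
  exteriorPower.alternatingMapLinearEquiv
    (alternate ((LinearMap.mul B R).compl₁₂ δ.liftKaehlerDifferential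
      δ'.liftKaehlerDifferential)) ω

/-- The value of a 2-form on two tangent vectors at a `K`-point `y`. -/
def TwoForm.evalAt {K : Type u} [CommRing K] [Algebra k K] (ω : TwoForm k B) (y : B →ₐ[k] K)
    (v v' : tangentSpace y) : K :=
  letI : Algebra B K := y.toAlgebra
  haveI : IsScalarTower k B K := IsScalarTower.of_algebraMap_eq' y.comp_algebraMap.symm
  ω.eval (tangentDerivation y v) (tangentDerivation y v')

/-- The contraction `ι_D ω` of a 2-form with a vector field `D`; it is determined by
`ι_D (df ∧ dg) = D f • dg - D g • df`. -/
def TwoForm.contract (D : Derivation k B B) (ω : TwoForm k B) : Ω[B⁄k] :=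
  exteriorPower.alternatingMapLinearEquiv
    (alternate ((LinearMap.lsmul B Ω[B⁄k]).comp D.liftKaehlerDifferential)) ω

/-- Pull-back of 2-forms along `Spec C ⟶ Spec B`, for a `B`-algebra `C`. -/
def TwoForm.pullbackAux (k : Type v) [Field k] (B C : Type u) [CommRing B] [Algebra k B]
    [CommRing C] [Algebra k C] [Algebra B C] [IsScalarTower k B C] :
    TwoForm k B →ₗ[B] TwoForm k C :=
  exteriorPower.alternatingMapLinearEquiv
    { toFun := fun m => exteriorPower.ιMulti C 2 fun i => KaehlerDifferential.map k k B C (m i)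
      map_update_add' := by
        intro _ m i x y
        have h : ∀ z, (fun j => KaehlerDifferential.map k k B C (Function.update m i z j)) =
            Function.update (fun j => KaehlerDifferential.map k k B C (m j)) i
              (KaehlerDifferential.map k k B C z) := by
          intro z
          funext j
          by_cases hj : j = i
          · subst hj; simp
          · simp [hj]
        simp only [h, map_add, AlternatingMap.map_update_add]
      map_update_smul' := by
        intro _ m i c x
        have h : ∀ z, (fun j => KaehlerDifferential.map k k B C (Function.update m i z j)) =
            Function.update (fun j => KaehlerDifferential.map k k B C (m j)) i
              (KaehlerDifferential.map k k B C z) := by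
          intro z
          funext j
          by_cases hj : j = i
          · subst hj; simp
          · simp [hj]
        simp only [h, map_smul]
        rw [← algebraMap_smul C c (KaehlerDifferential.map k k B C x),
          AlternatingMap.map_update_smul, algebraMap_smul]
      map_eq_zero_of_eq' := by
        intro m i j hij hne
        exact AlternatingMap.map_eq_zero_of_eq _ _ (congrArg _ hij) hne }

/-- Pull-back of 2-forms along the morphism `Spec C ⟶ Spec B` given by `φ`; it is determined by
`φ^*(f dg ∧ dh) = φ f d(φ g) ∧ d(φ h)`. -/
def TwoForm.pullback {C : Type u} [CommRing C] [Algebra k C] (φ : B →ₐ[k] C)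
    (ω : TwoForm k B) : TwoForm k C :=
  letI : Algebra B C := φ.toAlgebra
  haveI : IsScalarTower k B C := IsScalarTower.of_algebraMap_eq' φ.comp_algebraMap.symm
  TwoForm.pullbackAux k B C ω

/-- The form `pr₁^* ω₁ + pr₂^* ω₂` on `Spec B × Spec C`. -/
def TwoForm.prod {C : Type u} [CommRing C] [Algebra k C] (ω₁ : TwoForm k B)
    (ω₂ : TwoForm k C) : TwoForm k (B ⊗[k] C) :=
  ω₁.pullback (Algebra.TensorProduct.includeLeft : B →ₐ[k] B ⊗[k] C) +
    ω₂.pullback (Algebra.TensorProduct.includeRight : C →ₐ[k] B ⊗[k] C)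

/-- `dω = 0`, by the invariant formula for `dω (D₁, D₂, D₃)`. On a smooth affine scheme a 3-form
vanishes as soon as it vanishes on all triples of vector fields. -/
def TwoForm.IsClosed (ω : TwoForm k B) : Prop :=
  ∀ D₁ D₂ D₃ : Derivation k B B,
    D₁ (ω.eval D₂ D₃) - D₂ (ω.eval D₁ D₃) + D₃ (ω.eval D₁ D₂)
      - ω.eval ⁅D₁, D₂⁆ D₃ + ω.eval ⁅D₁, D₃⁆ D₂ - ω.eval ⁅D₂, D₃⁆ D₁ = 0

/-- A symplectic form: closed, and `D ↦ ι_D ω` is an isomorphism from vector fields to 1-forms. -/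
structure TwoForm.IsSymplectic (ω : TwoForm k B) : Prop where
  closed : ω.IsClosed
  nondegenerate : Function.Bijective fun D : Derivation k B B => ω.contract D

/-- The Hamiltonian vector field `X_f` of `f`: the vector field with `ι_{X_f} ω = df`, which exists
and is unique if `ω` is nondegenerate. -/
def TwoForm.hamiltonianField (ω : TwoForm k B) (f : B) : Derivation k B B :=
  Function.invFun (fun D : Derivation k B B => ω.contract D) (KaehlerDifferential.D k B f)

/-- The Poisson bracket `{f, g} = ω (X_f, X_g) = X_g f` of a symplectic form. -/
def TwoForm.bracket (ω : TwoForm k B) (f g : B) : B := ω.hamiltonianField g f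

/-- The closed subscheme `V(I)` is coisotropic for the Poisson structure of `ω`. -/
def TwoForm.IsCoisotropic (ω : TwoForm k B) (I : Ideal B) : Prop :=
  ∀ f ∈ I, ∀ g ∈ I, ω.bracket f g ∈ I

/-- `ω` restricts to zero on the closed subscheme `V(I)`. -/
def TwoForm.IsIsotropic (ω : TwoForm k B) (I : Ideal B) : Prop :=
  ω.pullback (Ideal.Quotient.mkₐ k I) = 0

end Forms

/-! ### Affine groupoids -/

section Groupoid

variable {k : Type v} [Field k]
variable {A : Type u} [CommRing A] [Algebra k A]
variable {B : Type u} [CommRing B] [Algebra k B]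

/-- The ideal of the closed subscheme `Spec B ×_{s,t} Spec B` of `Spec B × Spec B`. -/
def fibreIdeal (s t : A →ₐ[k] B) : Ideal (B ⊗[k] B) :=
  Ideal.span (Set.range fun f : A => s f ⊗ₜ[k] (1 : B) - (1 : B) ⊗ₜ[k] t f)

/-- The coordinate algebra of the scheme `Spec B ×_{s,t} Spec B` of composable arrows. -/
abbrev Composable (s t : A →ₐ[k] B) : Type u := (B ⊗[k] B) ⧸ fibreIdeal s t

/-- The `R`-point `(g, h)` of the scheme of composable arrows. -/
def pairPoint {s t : A →ₐ[k] B} {R : Type w} [CommRing R] [Algebra k R] (g h : B →ₐ[k] R)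
    (hgh : g.comp s = h.comp t) : Composable s t →ₐ[k] R :=
  Ideal.Quotient.liftₐ (fibreIdeal s t)
    (Algebra.TensorProduct.lift g h fun _ _ => Commute.all _ _) (by
      intro a ha
      have hle : fibreIdeal s t ≤
          RingHom.ker (Algebra.TensorProduct.lift g h fun _ _ => Commute.all _ _) := by
        refine Ideal.span_le.2 ?_
        rintro _ ⟨f, rfl⟩
        have hf := DFunLike.congr_fun hgh f
        simp only [AlgHom.comp_apply] at hf
        simp [RingHom.mem_ker, hf]
      exact hle ha)

/-- The composite `g h` of two composable `R`-points, for a multiplication morphism with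
comorphism `μ`. -/
def compPoint {s t : A →ₐ[k] B} (μ : B →ₐ[k] Composable s t) {R : Type w} [CommRing R]
    [Algebra k R] (g h : B →ₐ[k] R) (hgh : g.comp s = h.comp t) : B →ₐ[k] R :=
  (pairPoint g h hgh).comp μ

variable (k A B) in
/-- A groupoid object `Spec B ⇉ Spec A` in affine `k`-schemes. The fields `s, t, e, inv, mul` are
the comorphisms of source, target, identity bisection, inversion and multiplication (two arrows
`g, h` being composable to `g h` if the source of `g` is the target of `h`). The laws say that these
morphisms make the `R`-valued points into a groupoid, for every `k`-algebra `R`. -/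
structure AffineGroupoid where
  /-- source -/
  s : A →ₐ[k] B
  /-- target -/
  t : A →ₐ[k] B
  /-- identity bisection -/
  e : B →ₐ[k] A
  /-- inversion -/
  inv : B →ₐ[k] B
  /-- multiplication -/
  mul : B →ₐ[k] Composable s t
  e_comp_s : e.comp s = AlgHom.id k A
  e_comp_t : e.comp t = AlgHom.id k A
  inv_comp_s : inv.comp s = t
  inv_comp_t : inv.comp t = s
  comp_source : ∀ {R : Type u} [CommRing R] [Algebra k R] (g h : B →ₐ[k] R)
    (hgh : g.comp s = h.comp t), (compPoint mul g h hgh).comp s = h.comp s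
  comp_target : ∀ {R : Type u} [CommRing R] [Algebra k R] (g h : B →ₐ[k] R)
    (hgh : g.comp s = h.comp t), (compPoint mul g h hgh).comp t = g.comp t
  one_comp : ∀ {R : Type u} [CommRing R] [Algebra k R] (g : B →ₐ[k] R)
    (hg : ((g.comp t).comp e).comp s = g.comp t),
    compPoint mul ((g.comp t).comp e) g hg = g
  comp_one : ∀ {R : Type u} [CommRing R] [Algebra k R] (g : B →ₐ[k] R)
    (hg : g.comp s = ((g.comp s).comp e).comp t),
    compPoint mul g ((g.comp s).comp e) hg = g
  comp_assoc : ∀ {R : Type u} [CommRing R] [Algebra k R] (g h l : B →ₐ[k] R)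
    (hgh : g.comp s = h.comp t) (hhl : h.comp s = l.comp t)
    (h₁ : (compPoint mul g h hgh).comp s = l.comp t)
    (h₂ : g.comp s = (compPoint mul h l hhl).comp t),
    compPoint mul (compPoint mul g h hgh) l h₁ = compPoint mul g (compPoint mul h l hhl) h₂
  inv_comp : ∀ {R : Type u} [CommRing R] [Algebra k R] (g : B →ₐ[k] R)
    (hg : (g.comp inv).comp s = g.comp t),
    compPoint mul (g.comp inv) g hg = (g.comp s).comp e
  comp_inv : ∀ {R : Type u} [CommRing R] [Algebra k R] (g : B →ₐ[k] R)
    (hg : g.comp s = (g.comp inv).comp t),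
    compPoint mul g (g.comp inv) hg = (g.comp t).comp e

namespace AffineGroupoid

/-- The ideal in `k[G] ⊗ k[G] ⊗ k[G]` of the graph `{(g, h, g h)}` of multiplication. -/
def graphIdeal (Γ : AffineGroupoid k A B) : Ideal ((B ⊗[k] B) ⊗[k] B) :=
  RingHom.ker (Algebra.TensorProduct.lift (Ideal.Quotient.mkₐ k (fibreIdeal Γ.s Γ.t)) Γ.mul
    (fun _ _ => Commute.all _ _))

/-- `Spec B ⇉ Spec A` is an affine algebraic Lie groupoid: `Spec A` and `Spec B` are smooth
varieties (a smooth algebra over a field is reduced and of finite type), and the source and target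
morphisms are smooth. -/
structure IsLie (Γ : AffineGroupoid k A B) : Prop where
  smooth_base : Algebra.Smooth k A
  smooth_arrows : Algebra.Smooth k B
  smooth_s : (Γ.s : A →+* B).Smooth
  smooth_t : (Γ.t : A →+* B).Smooth

/-- `(Γ, ω)` is an affine symplectic groupoid: `Γ` is an affine algebraic Lie groupoid, `ω` is a
symplectic form on its scheme of arrows `G`, and the graph of multiplication is coisotropic in
`G × G × G⁻`. -/
structure IsSymplectic (Γ : AffineGroupoid k A B) (ω : TwoForm k B) : Prop where
  isLie : Γ.IsLie
  symplectic : ω.IsSymplectic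
  multiplicative : ((ω.prod ω).prod (-ω)).IsCoisotropic Γ.graphIdeal

/-- `V(J) ⇉ V(I)` is a smooth closed subgroupoid of `Γ` over the smooth closed subscheme `V(I)`:
the structure morphisms restrict (for multiplication, on `R`-points), and the result is again an
affine algebraic Lie groupoid. -/
structure IsSmoothClosedSubgroupoid (Γ : AffineGroupoid k A B) (J : Ideal B) (I : Ideal A) :
    Prop where
  s_mem : I ≤ J.comap (Γ.s : A →+* B)
  t_mem : I ≤ J.comap (Γ.t : A →+* B)
  e_mem : J ≤ I.comap (Γ.e : B →+* A)
  inv_mem : J ≤ J.comap (Γ.inv : B →+* B)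
  mul_mem : ∀ {R : Type u} [CommRing R] [Algebra k R] (g h : B →ₐ[k] R)
    (hgh : g.comp Γ.s = h.comp Γ.t), (∀ b ∈ J, g b = 0) → (∀ b ∈ J, h b = 0) →
    ∀ b ∈ J, compPoint Γ.mul g h hgh b = 0
  smooth_base : Algebra.Smooth k (A ⧸ I)
  smooth_arrows : Algebra.Smooth k (B ⧸ J)
  smooth_s : (Ideal.quotientMap J (Γ.s : A →+* B) s_mem).Smooth
  smooth_t : (Ideal.quotientMap J (Γ.t : A →+* B) t_mem).Smooth

/-- The Poisson bracket on the base of a symplectic groupoid, for which the target morphism is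
Poisson: `t^*{f, g} = {t^*f, t^*g}`, hence `{f, g} = 1^*{t^*f, t^*g}`. -/
def baseBracket (Γ : AffineGroupoid k A B) (ω : TwoForm k B) (f g : A) : A :=
  Γ.e (ω.bracket (Γ.t f) (Γ.t g))

variable {K : Type u} [CommRing K] [Algebra k K]

/-- The value at the `K`-point `x` of the vector field `g ↦ {g, f}` on the base. -/
def baseField (Γ : AffineGroupoid k A B) (ω : TwoForm k B) (x : A →ₐ[k] K) (f : A) :
    tangentSpace x :=
  ⟨x.toLinearMap ∘ₗ Γ.e.toLinearMap ∘ₗ (ω.hamiltonianField (Γ.t f) : B →ₗ[k] B) ∘ₗ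
      Γ.t.toLinearMap, by
    intro a b
    have h : ∀ c, Γ.e (Γ.t c) = c := fun c => DFunLike.congr_fun Γ.e_comp_t c
    simp [h]⟩

lemma baseField_apply (Γ : AffineGroupoid k A B) (ω : TwoForm k B) (x : A →ₐ[k] K) (f g : A) :
    (Γ.baseField ω x f).1 g = x (Γ.baseBracket ω g f) := rfl

/-- The covector `ξ` at `x` lies in the conormal space of `V(I)`: it kills `T_x V(I)`. -/
def IsConormal (I : Ideal A) (x : A →ₐ[k] K) (ξ : Module.Dual K (tangentSpace x)) : Prop :=
  ∀ w : tangentSpace x, (∀ f ∈ I, w.1 f = 0) → ξ w = 0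

/-- `σ(ξ) ∈ T_x V(I)`, where `σ` is contraction with the Poisson bivector `π` of the base. Since
`σ(ξ) f = π(ξ, df) = ξ (g ↦ {g, f}(x))`, the condition is that this vanishes for all `f ∈ I`. -/
def AnchorTangent (Γ : AffineGroupoid k A B) (ω : TwoForm k B) (I : Ideal A) (x : A →ₐ[k] K)
    (ξ : Module.Dual K (tangentSpace x)) : Prop :=
  ∀ f ∈ I, ξ (Γ.baseField ω x f) = 0

/-- The covector `ξ` at `x` lies in the Lie algebroid of the subgroupoid with arrows `V(J)`. The
fibre of that Lie algebroid at `x` consists of the vectors `v` at the identity arrow `1(x)` that are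
tangent to `V(J)` and to the source fibre, and the Lie algebroid of `Γ` is identified with
the cotangent bundle of the base by `v ↦ (w ↦ ω (v, d1 (w)))`. -/
def InLieAlgebroid (Γ : AffineGroupoid k A B) (ω : TwoForm k B) (J : Ideal B) (x : A →ₐ[k] K)
    (ξ : Module.Dual K (tangentSpace x)) : Prop :=
  ∃ v : tangentSpace (x.comp Γ.e),
    tangentMap Γ.s (x.comp Γ.e) v = 0 ∧ (∀ b ∈ J, v.1 b = 0) ∧
    ∀ w : tangentSpace x, ξ w = ω.evalAt (x.comp Γ.e) v (tangentMap Γ.e x w)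

/-- `V(J) ⇉ V(I)` is a stabilizer subgroupoid of `(Γ, ω)`: a smooth closed subgroupoid over the
smooth closed subvariety `S = V(I)`, isotropic, and with Lie algebroid `N^*S ∩ σ⁻¹(TS)`; the last
condition is an equality of subspaces of the cotangent space at every field-valued point of `S`. -/
structure IsStabilizerSubgroupoid (Γ : AffineGroupoid k A B) (ω : TwoForm k B) (J : Ideal B)
    (I : Ideal A) : Prop where
  subgroupoid : Γ.IsSmoothClosedSubgroupoid J I
  isotropic : ω.IsIsotropic J
  lieAlgebroid : ∀ {K : Type u} [Field K] [Algebra k K] (x : A →ₐ[k] K), (∀ f ∈ I, x f = 0) →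
    ∀ ξ : Module.Dual K (tangentSpace x),
      Γ.InLieAlgebroid ω J x ξ ↔ IsConormal I x ξ ∧ Γ.AnchorTangent ω I x ξ

end AffineGroupoid

end Groupoid

/-! ### Products and the diagonal -/

section Product

variable {k : Type v} [Field k]
variable {A₁ : Type u} [CommRing A₁] [Algebra k A₁] {B₁ : Type u} [CommRing B₁] [Algebra k B₁]
variable {A₂ : Type u} [CommRing A₂] [Algebra k A₂] {B₂ : Type u} [CommRing B₂] [Algebra k B₂]
variable {R : Type u} [CommRing R] [Algebra k R]

open Algebra.TensorProduct

/-- The comorphism of multiplication of a product of two groupoids. -/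
def prodMul {s₁ t₁ : A₁ →ₐ[k] B₁} {s₂ t₂ : A₂ →ₐ[k] B₂} (μ₁ : B₁ →ₐ[k] Composable s₁ t₁)
    (μ₂ : B₂ →ₐ[k] Composable s₂ t₂) :
    B₁ ⊗[k] B₂ →ₐ[k] Composable (map s₁ s₂) (map t₁ t₂) :=
  let p : (B₁ ⊗[k] B₂) →ₐ[k] Composable (map s₁ s₂) (map t₁ t₂) :=
    (Ideal.Quotient.mkₐ k (fibreIdeal (map s₁ s₂) (map t₁ t₂))).comp includeLeft
  let q : (B₁ ⊗[k] B₂) →ₐ[k] Composable (map s₁ s₂) (map t₁ t₂) :=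
    (Ideal.Quotient.mkₐ k (fibreIdeal (map s₁ s₂) (map t₁ t₂))).comp includeRight
  have hpq : ∀ a, p (map s₁ s₂ a) = q (map t₁ t₂ a) := fun a => by
    refine (Ideal.Quotient.eq (I := fibreIdeal (map s₁ s₂) (map t₁ t₂))).2 ?_
    exact Ideal.subset_span ⟨a, rfl⟩
  lift
    (compPoint μ₁ (p.comp includeLeft) (q.comp includeLeft)
      (by ext a; simpa using hpq (a ⊗ₜ 1)))
    (compPoint μ₂ (p.comp includeRight) (q.comp includeRight)
      (by ext a; simpa using hpq (1 ⊗ₜ a)))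
    (fun _ _ => Commute.all _ _)

lemma pairPoint_mk_tmul {A B : Type u} [CommRing A] [Algebra k A] [CommRing B] [Algebra k B]
    {s t : A →ₐ[k] B} (g h : B →ₐ[k] R) (hgh : g.comp s = h.comp t) (a b : B) :
    pairPoint g h hgh (Ideal.Quotient.mkₐ k (fibreIdeal s t) (a ⊗ₜ b)) = g a * h b := by
  change Algebra.TensorProduct.lift g h (fun _ _ => Commute.all _ _) (a ⊗ₜ b) = g a * h b
  simp

lemma comp_compPoint {A B : Type u} [CommRing A] [Algebra k A] [CommRing B] [Algebra k B]
    {R' : Type u} [CommRing R'] [Algebra k R']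
    {s t : A →ₐ[k] B} (μ : B →ₐ[k] Composable s t) (φ : R →ₐ[k] R') (g h : B →ₐ[k] R)
    (hgh : g.comp s = h.comp t) (hgh' : (φ.comp g).comp s = (φ.comp h).comp t) :
    φ.comp (compPoint μ g h hgh) = compPoint μ (φ.comp g) (φ.comp h) hgh' := by
  have : φ.comp (pairPoint g h hgh) = pairPoint (φ.comp g) (φ.comp h) hgh' := by
    apply Ideal.Quotient.algHom_ext
    apply Algebra.TensorProduct.ext'
    intro a b
    simp only [AlgHom.comp_apply, pairPoint_mk_tmul, map_mul]
  rw [compPoint, compPoint, ← AlgHom.comp_assoc, this]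

lemma compPoint_congr {A B : Type u} [CommRing A] [Algebra k A] [CommRing B] [Algebra k B]
    {s t : A →ₐ[k] B} (μ : B →ₐ[k] Composable s t) {g g' h h' : B →ₐ[k] R}
    (hg : g = g') (hh : h = h') (hgh : g.comp s = h.comp t) (hgh' : g'.comp s = h'.comp t) :
    compPoint μ g h hgh = compPoint μ g' h' hgh' := by
  subst hg hh; rfl

variable {s₁ t₁ : A₁ →ₐ[k] B₁} {s₂ t₂ : A₂ →ₐ[k] B₂} (μ₁ : B₁ →ₐ[k] Composable s₁ t₁)
    (μ₂ : B₂ →ₐ[k] Composable s₂ t₂)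

lemma comp_left {g h : B₁ ⊗[k] B₂ →ₐ[k] R} (hgh : g.comp (map s₁ s₂) = h.comp (map t₁ t₂)) :
    (g.comp includeLeft).comp s₁ = (h.comp includeLeft).comp t₁ := by
  ext a; simpa using DFunLike.congr_fun hgh (a ⊗ₜ 1)

lemma comp_right {g h : B₁ ⊗[k] B₂ →ₐ[k] R} (hgh : g.comp (map s₁ s₂) = h.comp (map t₁ t₂)) :
    (g.comp includeRight).comp s₂ = (h.comp includeRight).comp t₂ := by
  ext a; simpa using DFunLike.congr_fun hgh (1 ⊗ₜ a)

lemma lift_right (g : B₁ →ₐ[k] R) (h : B₂ →ₐ[k] R) (H : ∀ x y, Commute (g x) (h y)) :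
    (lift g h H).comp includeRight = h := by
  ext a; simp

/-- The composite of `R`-points of a product is computed in each factor. -/
lemma compPoint_prodMul (g h : B₁ ⊗[k] B₂ →ₐ[k] R)
    (hgh : g.comp (map s₁ s₂) = h.comp (map t₁ t₂)) :
    compPoint (prodMul μ₁ μ₂) g h hgh =
      lift (compPoint μ₁ (g.comp includeLeft) (h.comp includeLeft) (comp_left hgh))
        (compPoint μ₂ (g.comp includeRight) (h.comp includeRight) (comp_right hgh))
        (fun _ _ => Commute.all _ _) := by
  have hp : ∀ a, pairPoint g h hgh (Ideal.Quotient.mkₐ k _ (a ⊗ₜ 1)) = g a := by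
    intro a; simp [pairPoint_mk_tmul, -Ideal.Quotient.mkₐ_eq_mk]
  have hq : ∀ a, pairPoint g h hgh (Ideal.Quotient.mkₐ k _ (1 ⊗ₜ a)) = h a := by
    intro a; simp [pairPoint_mk_tmul, -Ideal.Quotient.mkₐ_eq_mk]
  apply Algebra.TensorProduct.ext
  · rw [lift_comp_includeLeft, compPoint, AlgHom.comp_assoc, prodMul, lift_comp_includeLeft]
    have H : ∀ (a b : B₁ →ₐ[k] Composable (map s₁ s₂) (map t₁ t₂)) (hab)
        (_ : (pairPoint g h hgh).comp a = g.comp includeLeft)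
        (_ : (pairPoint g h hgh).comp b = h.comp includeLeft),
        (pairPoint g h hgh).comp (compPoint μ₁ a b hab) =
          compPoint μ₁ (g.comp includeLeft) (h.comp includeLeft) (comp_left hgh) := by
      intro a b hab ha hb
      rw [comp_compPoint μ₁ (pairPoint g h hgh) a b hab (by rw [ha, hb]; exact comp_left hgh)]
      exact compPoint_congr μ₁ ha hb _ _
    apply H
    · ext a; exact hp _
    · ext a; exact hq _
  · have H : ∀ (a b : B₂ →ₐ[k] Composable (map s₁ s₂) (map t₁ t₂)) (hab)
        (_ : (pairPoint g h hgh).comp a = g.comp includeRight)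
        (_ : (pairPoint g h hgh).comp b = h.comp includeRight),
        (pairPoint g h hgh).comp (compPoint μ₂ a b hab) =
          compPoint μ₂ (g.comp includeRight) (h.comp includeRight) (comp_right hgh) := by
      intro a b hab ha hb
      rw [comp_compPoint μ₂ (pairPoint g h hgh) a b hab (by rw [ha, hb]; exact comp_right hgh)]
      exact compPoint_congr μ₂ ha hb _ _
    refine Eq.trans ?_ (lift_right _ _ (fun _ _ => Commute.all _ _)).symm
    change (compPoint (prodMul μ₁ μ₂) g h hgh).comp includeRight = _
    rw [compPoint, AlgHom.comp_assoc, prodMul, lift_right]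
    apply H
    · ext a; exact hp _
    · ext a; exact hq _

/-- Morphisms out of `B₁ ⊗ B₂` are determined by their two components. -/
lemma tensor_ext {f g : B₁ ⊗[k] B₂ →ₐ[k] R} (h₁ : f.comp includeLeft = g.comp includeLeft)
    (h₂ : f.comp includeRight = g.comp includeRight) : f = g :=
  Algebra.TensorProduct.ext h₁ h₂

lemma compPoint_prodMul_left (g h : B₁ ⊗[k] B₂ →ₐ[k] R)
    (hgh : g.comp (map s₁ s₂) = h.comp (map t₁ t₂)) :
    (compPoint (prodMul μ₁ μ₂) g h hgh).comp includeLeft =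
      compPoint μ₁ (g.comp includeLeft) (h.comp includeLeft) (comp_left hgh) := by
  rw [compPoint_prodMul, lift_comp_includeLeft]

lemma compPoint_prodMul_right (g h : B₁ ⊗[k] B₂ →ₐ[k] R)
    (hgh : g.comp (map s₁ s₂) = h.comp (map t₁ t₂)) :
    (compPoint (prodMul μ₁ μ₂) g h hgh).comp includeRight =
      compPoint μ₂ (g.comp includeRight) (h.comp includeRight) (comp_right hgh) := by
  rw [compPoint_prodMul, lift_right]

lemma comp_map_left {C₁ C₂ : Type u} [CommRing C₁] [Algebra k C₁] [CommRing C₂] [Algebra k C₂]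
    (g : B₁ ⊗[k] B₂ →ₐ[k] R) (φ₁ : C₁ →ₐ[k] B₁) (φ₂ : C₂ →ₐ[k] B₂) :
    (g.comp (map φ₁ φ₂)).comp includeLeft = (g.comp includeLeft).comp φ₁ := by
  ext a; simp

lemma comp_map_right {C₁ C₂ : Type u} [CommRing C₁] [Algebra k C₁] [CommRing C₂] [Algebra k C₂]
    (g : B₁ ⊗[k] B₂ →ₐ[k] R) (φ₁ : C₁ →ₐ[k] B₁) (φ₂ : C₂ →ₐ[k] B₂) :
    (g.comp (map φ₁ φ₂)).comp includeRight = (g.comp includeRight).comp φ₂ := by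
  ext a; simp

/-- The product of two affine groupoids. -/
def AffineGroupoid.prod (Γ₁ : AffineGroupoid k A₁ B₁) (Γ₂ : AffineGroupoid k A₂ B₂) :
    AffineGroupoid k (A₁ ⊗[k] A₂) (B₁ ⊗[k] B₂) where
  s := map Γ₁.s Γ₂.s
  t := map Γ₁.t Γ₂.t
  e := map Γ₁.e Γ₂.e
  inv := map Γ₁.inv Γ₂.inv
  mul := prodMul Γ₁.mul Γ₂.mul
  e_comp_s := by rw [← map_comp, Γ₁.e_comp_s, Γ₂.e_comp_s, map_id]
  e_comp_t := by rw [← map_comp, Γ₁.e_comp_t, Γ₂.e_comp_t, map_id]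
  inv_comp_s := by rw [← map_comp, Γ₁.inv_comp_s, Γ₂.inv_comp_s]
  inv_comp_t := by rw [← map_comp, Γ₁.inv_comp_t, Γ₂.inv_comp_t]
  comp_source g h hgh := by
    apply tensor_ext
    · rw [comp_map_left, comp_map_left, compPoint_prodMul_left, Γ₁.comp_source]
    · rw [comp_map_right, comp_map_right, compPoint_prodMul_right, Γ₂.comp_source]
  comp_target g h hgh := by
    apply tensor_ext
    · rw [comp_map_left, comp_map_left, compPoint_prodMul_left, Γ₁.comp_target]
    · rw [comp_map_right, comp_map_right, compPoint_prodMul_right, Γ₂.comp_target]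
  one_comp g hg := by
    apply tensor_ext
    · rw [compPoint_prodMul_left]
      simp only [comp_map_left]
      exact Γ₁.one_comp _ _
    · rw [compPoint_prodMul_right]
      simp only [comp_map_right]
      exact Γ₂.one_comp _ _
  comp_one g hg := by
    apply tensor_ext
    · rw [compPoint_prodMul_left]
      simp only [comp_map_left]
      exact Γ₁.comp_one _ _
    · rw [compPoint_prodMul_right]
      simp only [comp_map_right]
      exact Γ₂.comp_one _ _
  comp_assoc g h l hgh hhl h₁ h₂ := by
    apply tensor_ext
    · simp only [compPoint_prodMul_left]
      exact Γ₁.comp_assoc _ _ _ _ _ _ _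
    · simp only [compPoint_prodMul_right]
      exact Γ₂.comp_assoc _ _ _ _ _ _ _
  inv_comp g hg := by
    apply tensor_ext
    · rw [compPoint_prodMul_left]
      simp only [comp_map_left]
      exact Γ₁.inv_comp _ _
    · rw [compPoint_prodMul_right]
      simp only [comp_map_right]
      exact Γ₂.inv_comp _ _
  comp_inv g hg := by
    apply tensor_ext
    · rw [compPoint_prodMul_left]
      simp only [comp_map_left]
      exact Γ₁.comp_inv _ _
    · rw [compPoint_prodMul_right]
      simp only [comp_map_right]
      exact Γ₂.comp_inv _ _

variable (k) in
/-- The ideal of the diagonal in `Spec A × Spec A`. -/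
def diagonalIdeal (A : Type u) [CommRing A] [Algebra k A] : Ideal (A ⊗[k] A) :=
  RingHom.ker (lmul' k : A ⊗[k] A →ₐ[k] A)

end Product

end AffSympl

end

/-! The product. Nondegeneracy and closedness are checked on generators. Contraction with a product
form hits all d(b ⊗ 1) and d(1 ⊗ c), which generate the 1-forms, and a surjective contraction is
automatically injective. Hence the vector fields coming from the two factors generate all vector
fields, and closedness need only be tested on those (`TwoForm.IsSymplectic.prod`). A point of the
graph of the product multiplication is a pair of points of the two graphs, so its ideal is generated
by the two pulled back graph ideals (`graphIdeal_prod`). Functions from different factors Poisson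
commute, and each projection preserves brackets up to sign, so coisotropy is inherited.

The diagonal. It is a copy of G, hence smooth, and the forms -ω and ω cancel on it. It is also
coisotropic in G⁻ × G, which makes the anchor condition automatic for covectors conormal to ΔX. What
remains is that the Lie algebroid of ΔG is the conormal bundle of ΔX. One inclusion is isotropy of
ΔG. For the other, a conormal ξ is determined by its restriction η to vectors (0, u). If v₀ lies in
ker ds and ω(v₀, d1(u)) = η(u) for all u, then (v₀, v₀) represents ξ.

Such a v₀ exists because the identity bisection is isotropic (`IsSymplectic.evalAt_unitProj`), the
main point of the pointwise analysis. At a unit put P = d1∘ds and Q = d1∘dt, two projections with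
the same range. Vectors tangent to the graph of multiplication have the form (g, l, g + l - Pg). By
coisotropy, a vector orthogonal to all of these is tangent to the graph. Testing (z, z, z) shows
that the range of P is coisotropic; testing (0, z, z) shows that the orthogonal of ker P lies in ker
Q. A dimension count then makes the range of P Lagrangian. -/

noncomputable section

namespace AffSympl

/-! ### Calculus of 2-forms: evaluation, contraction, pull-back. -/

section FormCalculus

variable {k : Type v} [Field k] {B : Type u} [CommRing B] [Algebra k B]

variable (k) in
/-- The 2-form `df ∧ dg`. -/
def dwedge (f g : B) : TwoForm k B :=
  exteriorPower.ιMulti B 2 ![KaehlerDifferential.D k B f, KaehlerDifferential.D k B g]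

theorem span_range_dwedge :
    Submodule.span B (Set.range fun p : B × B => dwedge k p.1 p.2) = ⊤ := by
  rw [eq_top_iff, ← exteriorPower.ιMulti_span, Submodule.span_le]
  rintro _ ⟨m, rfl⟩
  have hm : m = ![m 0, m 1] := by ext i; fin_cases i <;> rfl
  have hD : ∀ x : Ω[B⁄k], x ∈ Submodule.span B (Set.range (KaehlerDifferential.D k B)) := by
    intro x; rw [KaehlerDifferential.span_range_derivation]; trivial
  have key : ∀ x y : Ω[B⁄k], exteriorPower.ιMulti B 2 ![x, y] ∈
      Submodule.span B (Set.range fun p : B × B => dwedge k p.1 p.2) := by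
    intro x y
    have h0 : ∀ x x' y : Ω[B⁄k], Function.update ![x, y] 0 x' = ![x', y] := by
      intro x x' y; ext i; fin_cases i <;> rfl
    have h1 : ∀ x y y' : Ω[B⁄k], Function.update ![x, y] 1 y' = ![x, y'] := by
      intro x y y'; ext i; fin_cases i <;> rfl
    induction hD x using Submodule.span_induction with
    | mem x hx =>
      obtain ⟨f, rfl⟩ := hx
      induction hD y using Submodule.span_induction with
      | mem y hy => obtain ⟨g, rfl⟩ := hy; exact Submodule.subset_span ⟨(f, g), rfl⟩
      | zero =>
        rw [(exteriorPower.ιMulti B 2).map_coord_zero 1 rfl]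
        exact zero_mem _
      | add y z _ _ hy hz =>
        have := (exteriorPower.ιMulti B 2).map_update_add ![KaehlerDifferential.D k B f, y] 1 y z
        simp only [h1] at this
        rw [this]; exact add_mem hy hz
      | smul c y _ hy =>
        have := (exteriorPower.ιMulti B 2).map_update_smul ![KaehlerDifferential.D k B f, y] 1 c y
        simp only [h1] at this
        rw [this]; exact Submodule.smul_mem _ _ hy
    | zero =>
      rw [(exteriorPower.ιMulti B 2).map_coord_zero 0 rfl]
      exact zero_mem _
    | add x z _ _ hx hz =>
      have := (exteriorPower.ιMulti B 2).map_update_add ![x, y] 0 x z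
      simp only [h0] at this
      rw [this]; exact add_mem hx hz
    | smul c x _ hx =>
      have := (exteriorPower.ιMulti B 2).map_update_smul ![x, y] 0 c x
      simp only [h0] at this
      rw [this]; exact Submodule.smul_mem _ _ hx
  rw [hm]
  exact key _ _

-- The forms df ∧ dg span, so an identity compatible with sums and scalars is checked on them alone.
-- The formulas of the calculus below are proved in this way.
@[elab_as_elim]
theorem TwoForm.induction {p : TwoForm k B → Prop} (dwedge : ∀ f g, p (dwedge k f g))
    (zero : p 0) (add : ∀ ω η, p ω → p η → p (ω + η)) (smul : ∀ (b : B) ω, p ω → p (b • ω))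
    (ω : TwoForm k B) : p ω := by
  have hω : ω ∈ Submodule.span B (Set.range fun q : B × B => AffSympl.dwedge k q.1 q.2) := by
    rw [span_range_dwedge]; trivial
  induction hω using Submodule.span_induction with
  | mem x hx => obtain ⟨q, rfl⟩ := hx; exact dwedge _ _
  | zero => exact zero
  | add x y _ _ hx hy => exact add _ _ hx hy
  | smul c x _ hx => exact smul _ _ hx

namespace TwoForm

section Eval

variable {R : Type u} [CommRing R] [Algebra k R] [Algebra B R] [IsScalarTower k B R]
variable (δ δ' : Derivation k B R)

@[simp] lemma eval_zero : (0 : TwoForm k B).eval δ δ' = 0 := map_zero _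

@[simp] lemma eval_add (ω η : TwoForm k B) :
    (ω + η).eval δ δ' = ω.eval δ δ' + η.eval δ δ' := map_add _ _ _

@[simp] lemma eval_smul (b : B) (ω : TwoForm k B) :
    (b • ω).eval δ δ' = algebraMap B R b * ω.eval δ δ' := by
  rw [← Algebra.smul_def]; exact map_smul _ _ _

@[simp] lemma eval_dwedge (f g : B) :
    (dwedge k f g).eval δ δ' = δ f * δ' g - δ g * δ' f := by
  simp [TwoForm.eval, dwedge, alternate]

end Eval

section EvalAt

variable {K : Type u} [CommRing K] [Algebra k K] (y : B →ₐ[k] K) (v v' : tangentSpace y)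

@[simp] lemma evalAt_zero : (0 : TwoForm k B).evalAt y v v' = 0 := map_zero _

@[simp] lemma evalAt_add (ω η : TwoForm k B) :
    (ω + η).evalAt y v v' = ω.evalAt y v v' + η.evalAt y v v' := map_add _ _ _

@[simp] lemma evalAt_neg (ω : TwoForm k B) :
    (-ω).evalAt y v v' = -ω.evalAt y v v' := map_neg _ _

@[simp] lemma evalAt_smul (b : B) (ω : TwoForm k B) :
    (b • ω).evalAt y v v' = y b * ω.evalAt y v v' := by
  let _ : Algebra B K := y.toAlgebra
  have : IsScalarTower k B K := IsScalarTower.of_algebraMap_eq' y.comp_algebraMap.symm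
  exact eval_smul _ _ b ω

@[simp] lemma evalAt_dwedge (f g : B) :
    (dwedge k f g).evalAt y v v' = v.1 f * v'.1 g - v.1 g * v'.1 f := by
  let _ : Algebra B K := y.toAlgebra
  have : IsScalarTower k B K := IsScalarTower.of_algebraMap_eq' y.comp_algebraMap.symm
  exact eval_dwedge _ _ f g

end EvalAt

section Contract

variable (D : Derivation k B B)

@[simp] lemma contract_zero : (0 : TwoForm k B).contract D = 0 := map_zero _

@[simp] lemma contract_add (ω η : TwoForm k B) :
    (ω + η).contract D = ω.contract D + η.contract D := map_add _ _ _

@[simp] lemma contract_neg (ω : TwoForm k B) :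
    (-ω).contract D = -ω.contract D := map_neg _ _

@[simp] lemma contract_smul (b : B) (ω : TwoForm k B) :
    (b • ω).contract D = b • ω.contract D := map_smul _ _ _

@[simp] lemma contract_dwedge (f g : B) :
    (dwedge k f g).contract D =
      D f • KaehlerDifferential.D k B g - D g • KaehlerDifferential.D k B f := by
  simp [TwoForm.contract, dwedge, alternate]

lemma contract_add_left (ω : TwoForm k B) (D E : Derivation k B B) :
    ω.contract (D + E) = ω.contract D + ω.contract E := by
  induction ω using TwoForm.induction with
  | dwedge f g => simp only [contract_dwedge, Derivation.add_apply, add_smul]; abel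
  | zero => simp
  | add ω η h h' => simp only [contract_add, h, h']; abel
  | smul b ω h => simp [h]

lemma contract_smul_left (ω : TwoForm k B) (b : B) (D : Derivation k B B) :
    ω.contract (b • D) = b • ω.contract D := by
  induction ω using TwoForm.induction with
  | dwedge f g => simp [smul_sub, smul_smul]
  | zero => simp
  | add ω η h h' => simp [h, h']
  | smul c ω h => simp [h, smul_smul, mul_comm]

/-- Contraction with a 2-form, as a linear map from vector fields to 1-forms. -/
def flat (ω : TwoForm k B) : Derivation k B B →ₗ[B] Ω[B⁄k] where
  toFun D := ω.contract D
  map_add' := contract_add_left ω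
  map_smul' := contract_smul_left ω

@[simp] lemma flat_apply (ω : TwoForm k B) (D : Derivation k B B) : ω.flat D = ω.contract D := rfl

/-- Links contraction with evaluation: linearity of `eval` is read off from that of `contract`, and
the antisymmetry of `eval` becomes a statement about contraction. -/
lemma lift_contract (ω : TwoForm k B) (D E : Derivation k B B) :
    E.liftKaehlerDifferential (ω.contract D) = ω.eval D E := by
  induction ω using TwoForm.induction with
  | dwedge f g => simp
  | zero => simp
  | add ω η h h' => simp [h, h']
  | smul c ω h => simp [h]

lemma eval_swap (ω : TwoForm k B) (D E : Derivation k B B) : ω.eval D E = -ω.eval E D := by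
  induction ω using TwoForm.induction with
  | dwedge f g => simp only [eval_dwedge]; ring
  | zero => simp
  | add ω η h h' => simp only [eval_add, h, h']; ring
  | smul c ω h => simp only [eval_smul, h]; ring

lemma eval_add_left (ω : TwoForm k B) (D D' E : Derivation k B B) :
    ω.eval (D + D') E = ω.eval D E + ω.eval D' E := by
  simp only [← lift_contract, contract_add_left, map_add]

lemma eval_smul_left (ω : TwoForm k B) (b : B) (D E : Derivation k B B) :
    ω.eval (b • D) E = b * ω.eval D E := by
  simp only [← lift_contract, contract_smul_left, map_smul, smul_eq_mul]

lemma eval_add_right (ω : TwoForm k B) (D E E' : Derivation k B B) :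
    ω.eval D (E + E') = ω.eval D E + ω.eval D E' := by
  simp only [eval_swap ω D, eval_add_left]; ring

lemma eval_smul_right (ω : TwoForm k B) (b : B) (D E : Derivation k B B) :
    ω.eval D (b • E) = b * ω.eval D E := by
  simp only [eval_swap ω D, eval_smul_left]; ring

/-- If contraction with `ω` hits every 1-form, then it is injective on vector fields. -/
lemma contract_bijective_of_surjective {ω : TwoForm k B}
    (h : Function.Surjective fun D : Derivation k B B => ω.contract D) :
    Function.Bijective fun D : Derivation k B B => ω.contract D := by
  refine ⟨?_, h⟩
  have : Function.Injective ω.flat := by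
    rw [injective_iff_map_eq_zero]
    intro D hD
    ext b
    -- With ι_E ω = db one gets D b = ω(E, D) = -ω(D, E), which vanishes since ι_D ω = 0.
    obtain ⟨E, hE⟩ := h (KaehlerDifferential.D k B b)
    have := lift_contract ω E D
    rw [show ω.contract E = _ from hE, Derivation.liftKaehlerDifferential_comp_D, eval_swap,
      ← lift_contract, ← flat_apply, hD] at this
    simpa using this
  exact this

end Contract

section Pullback

variable {C : Type u} [CommRing C] [Algebra k C] (φ : B →ₐ[k] C)

@[simp] lemma pullback_zero : (0 : TwoForm k B).pullback φ = 0 := map_zero _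

@[simp] lemma pullback_add (ω η : TwoForm k B) :
    (ω + η).pullback φ = ω.pullback φ + η.pullback φ := map_add _ _ _

@[simp] lemma pullback_neg (ω : TwoForm k B) :
    (-ω).pullback φ = -ω.pullback φ := by
  let _ : Algebra B C := φ.toAlgebra
  have : IsScalarTower k B C := IsScalarTower.of_algebraMap_eq' φ.comp_algebraMap.symm
  exact map_neg (TwoForm.pullbackAux k B C) ω

@[simp] lemma pullback_smul (b : B) (ω : TwoForm k B) :
    (b • ω).pullback φ = φ b • ω.pullback φ := by
  let _ : Algebra B C := φ.toAlgebra
  have : IsScalarTower k B C := IsScalarTower.of_algebraMap_eq' φ.comp_algebraMap.symm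
  exact (map_smul (TwoForm.pullbackAux k B C) b ω).trans (algebraMap_smul C b _).symm

@[simp] lemma pullback_dwedge (f g : B) :
    (dwedge k f g).pullback φ = dwedge k (φ f) (φ g) := by
  let _ : Algebra B C := φ.toAlgebra
  have : IsScalarTower k B C := IsScalarTower.of_algebraMap_eq' φ.comp_algebraMap.symm
  change TwoForm.pullbackAux k B C _ = _
  rw [TwoForm.pullbackAux, dwedge, exteriorPower.alternatingMapLinearEquiv_apply_ιMulti, dwedge]
  change exteriorPower.ιMulti C 2 _ = _
  congr 1
  ext i
  fin_cases i
  · exact KaehlerDifferential.map_D k k B C f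
  · exact KaehlerDifferential.map_D k k B C g

lemma pullback_comp {E : Type u} [CommRing E] [Algebra k E] (ψ : C →ₐ[k] E) (ω : TwoForm k B) :
    ω.pullback (ψ.comp φ) = (ω.pullback φ).pullback ψ := by
  induction ω using TwoForm.induction with
  | dwedge f g => simp
  | zero => simp
  | add ω η h h' => simp [h, h']
  | smul c ω h => simp [h]

/-- The point `y'` and the vectors `w`, `w'` are free variables tied by equations, because tangent
spaces at points that are only propositionally equal are different types. -/
lemma evalAt_pullback {K : Type u} [CommRing K] [Algebra k K] (ω : TwoForm k B)
    (y : C →ₐ[k] K) (y' : B →ₐ[k] K) (hy : y' = y.comp φ) (v v' : tangentSpace y)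
    (w w' : tangentSpace y') (hw : ∀ b, w.1 b = v.1 (φ b)) (hw' : ∀ b, w'.1 b = v'.1 (φ b)) :
    (ω.pullback φ).evalAt y v v' = ω.evalAt y' w w' := by
  induction ω using TwoForm.induction with
  | dwedge f g => simp [hw, hw']
  | zero => simp
  | add ω η h h' => simp [h, h']
  | smul c ω h => simp [h, hy]

/-- Contraction commutes with pull-back, for related vector fields. -/
lemma contract_pullback (ω : TwoForm k B) (D : Derivation k B B) (E : Derivation k C C)
    (h : ∀ b, E (φ b) = φ (D b)) {f : B} (hf : ω.contract D = KaehlerDifferential.D k B f) :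
    (ω.pullback φ).contract E = KaehlerDifferential.D k C (φ f) := by
  let _ : Algebra B C := φ.toAlgebra
  have : IsScalarTower k B C := IsScalarTower.of_algebraMap_eq' φ.comp_algebraMap.symm
  have key : (ω.pullback φ).contract E = KaehlerDifferential.map k k B C (ω.contract D) := by
    -- The identity `key` is linear in the form, whereas `hf` is not preserved by the induction.
    clear hf
    have hs : ∀ (b : B) (x : Ω[B⁄k]), KaehlerDifferential.map k k B C (b • x) =
        φ b • KaehlerDifferential.map k k B C x := by
      intro b x
      rw [map_smul]; exact (algebraMap_smul C b _).symm
    have hd : ∀ b : B, KaehlerDifferential.map k k B C (KaehlerDifferential.D k B b) =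
        KaehlerDifferential.D k C (φ b) := KaehlerDifferential.map_D k k B C
    induction ω using TwoForm.induction with
    | dwedge f g => simp only [pullback_dwedge, contract_dwedge, map_sub, hs, hd, h]
    | zero => simp
    | add ω η h h' => simp only [pullback_add, contract_add, map_add, h, h']
    | smul c ω h => simp only [pullback_smul, contract_smul, hs, h]
  rw [key, hf]
  exact KaehlerDifferential.map_D k k B C f

/-- A vector field along the fibres of a morphism contracts to zero with pulled back forms. -/
lemma contract_pullback_eq_zero (ω : TwoForm k B) (E : Derivation k C C)
    (h : ∀ b, E (φ b) = 0) : (ω.pullback φ).contract E = 0 := by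
  induction ω using TwoForm.induction with
  | dwedge f g => simp [h]
  | zero => simp
  | add ω η h h' => simp [h, h']
  | smul c ω h => simp [h]

lemma eval_pullback (ω : TwoForm k B) (D D' : Derivation k B B) (E E' : Derivation k C C)
    (h : ∀ b, E (φ b) = φ (D b)) (h' : ∀ b, E' (φ b) = φ (D' b)) :
    (ω.pullback φ).eval E E' = φ (ω.eval D D') := by
  induction ω using TwoForm.induction with
  | dwedge f g => simp [h, h']
  | zero => simp
  | add ω η h h' => simp [h, h']
  | smul c ω h => simp [h]

end Pullback

end TwoForm

end FormCalculus

/-! ### Hamiltonian fields, Poisson brackets and closedness. -/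

section Hamiltonian

variable {k : Type v} [Field k] {B : Type u} [CommRing B] [Algebra k B]

namespace TwoForm

/-- Nondegeneracy: contraction is a bijection from vector fields to 1-forms. -/
abbrev IsNondegenerate (ω : TwoForm k B) : Prop :=
  Function.Bijective fun D : Derivation k B B => ω.contract D

variable {ω : TwoForm k B}

lemma IsNondegenerate.contract_hamiltonianField (h : ω.IsNondegenerate) (f : B) :
    ω.contract (ω.hamiltonianField f) = KaehlerDifferential.D k B f :=
  Function.invFun_eq (f := fun D : Derivation k B B => ω.contract D) (h.2 _)

/-- Injectivity of contraction. It replaces the choice hidden in `Function.invFun` by the equation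
that characterizes the Hamiltonian field. -/
lemma IsNondegenerate.hamiltonianField_eq (h : ω.IsNondegenerate) {f : B} {D : Derivation k B B}
    (hD : ω.contract D = KaehlerDifferential.D k B f) : ω.hamiltonianField f = D :=
  h.1 ((h.contract_hamiltonianField f).trans hD.symm)

lemma IsNondegenerate.hamiltonianField_add (h : ω.IsNondegenerate) (f g : B) :
    ω.hamiltonianField (f + g) = ω.hamiltonianField f + ω.hamiltonianField g :=
  h.hamiltonianField_eq <| by
    simp only [contract_add_left, h.contract_hamiltonianField, map_add]

lemma IsNondegenerate.hamiltonianField_mul (h : ω.IsNondegenerate) (f g : B) :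
    ω.hamiltonianField (f * g) = f • ω.hamiltonianField g + g • ω.hamiltonianField f :=
  h.hamiltonianField_eq <| by
    simp only [contract_add_left, contract_smul_left, h.contract_hamiltonianField,
      Derivation.leibniz]

lemma IsNondegenerate.hamiltonianField_zero (h : ω.IsNondegenerate) :
    ω.hamiltonianField 0 = 0 :=
  h.hamiltonianField_eq <| by simpa using contract_smul_left ω 0 0

lemma IsNondegenerate.bracket_eq_eval (h : ω.IsNondegenerate) (f g : B) :
    ω.bracket f g = ω.eval (ω.hamiltonianField f) (ω.hamiltonianField g) := by
  rw [← lift_contract, h.contract_hamiltonianField, Derivation.liftKaehlerDifferential_comp_D,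
    TwoForm.bracket]

lemma IsNondegenerate.bracket_swap (h : ω.IsNondegenerate) (f g : B) :
    ω.bracket f g = -ω.bracket g f := by
  rw [h.bracket_eq_eval, eval_swap, h.bracket_eq_eval]

lemma bracket_add_left (f g l : B) : ω.bracket (f + g) l = ω.bracket f l + ω.bracket g l :=
  map_add _ _ _

lemma bracket_mul_left (f g l : B) :
    ω.bracket (f * g) l = f * ω.bracket g l + g * ω.bracket f l := by
  simp [TwoForm.bracket]

lemma bracket_zero_left (l : B) : ω.bracket 0 l = 0 := map_zero _

lemma IsNondegenerate.bracket_add_right (h : ω.IsNondegenerate) (f g l : B) :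
    ω.bracket f (g + l) = ω.bracket f g + ω.bracket f l := by
  simp [TwoForm.bracket, h.hamiltonianField_add]

lemma IsNondegenerate.bracket_mul_right (h : ω.IsNondegenerate) (f g l : B) :
    ω.bracket f (g * l) = g * ω.bracket f l + l * ω.bracket f g := by
  simp [TwoForm.bracket, h.hamiltonianField_mul]

lemma IsNondegenerate.bracket_zero_right (h : ω.IsNondegenerate) (f : B) :
    ω.bracket f 0 = 0 := by
  simp [TwoForm.bracket, h.hamiltonianField_zero]

lemma IsNondegenerate.neg (h : ω.IsNondegenerate) : (-ω).IsNondegenerate := by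
  have : (fun D : Derivation k B B => (-ω).contract D) = Neg.neg ∘ fun D => ω.contract D := by
    ext1 D; simp
  rw [IsNondegenerate, this]
  exact neg_involutive.bijective.comp h

lemma IsNondegenerate.hamiltonianField_neg (h : ω.IsNondegenerate) (f : B) :
    (-ω).hamiltonianField f = -ω.hamiltonianField f :=
  h.neg.hamiltonianField_eq <| by
    rw [contract_neg, ← h.contract_hamiltonianField, ← flat_apply, ← flat_apply, map_neg, neg_neg]

lemma IsNondegenerate.bracket_neg (h : ω.IsNondegenerate) (f g : B) :
    (-ω).bracket f g = -ω.bracket f g := by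
  simp [TwoForm.bracket, h.hamiltonianField_neg]

/-- To check that an ideal is closed under the bracket, generators suffice. -/
lemma IsNondegenerate.isCoisotropic_span (h : ω.IsNondegenerate) {s : Set B}
    (hs : ∀ f ∈ s, ∀ g ∈ s, ω.bracket f g ∈ Ideal.span s) : ω.IsCoisotropic (Ideal.span s) := by
  intro f hf g hg
  induction hf using Submodule.span_induction with
  | mem f hf =>
    induction hg using Submodule.span_induction with
    | mem g hg => exact hs f hf g hg
    | zero => rw [h.bracket_zero_right]; exact zero_mem _
    | add g l _ _ hg hl => rw [h.bracket_add_right]; exact add_mem hg hl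
    | smul c g hg' hg =>
      -- {f, cg} = c{f, g} + g{f, c}: the first term lies in the ideal by induction, the second
      -- because g does.
      rw [smul_eq_mul, h.bracket_mul_right]
      exact add_mem (Ideal.mul_mem_left _ _ hg) (Ideal.mul_mem_right _ _ hg')
  | zero => rw [bracket_zero_left]; exact zero_mem _
  | add f l _ _ hf hl => rw [bracket_add_left]; exact add_mem hf hl
  | smul c f hf' hf =>
    rw [smul_eq_mul, bracket_mul_left]
    exact add_mem (Ideal.mul_mem_left _ _ hf) (Ideal.mul_mem_right _ _ hf')

section Closed

/-- The value of `dω` on three vector fields. -/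
def extDeriv (ω : TwoForm k B) (D₁ D₂ D₃ : Derivation k B B) : B :=
  D₁ (ω.eval D₂ D₃) - D₂ (ω.eval D₁ D₃) + D₃ (ω.eval D₁ D₂)
      - ω.eval ⁅D₁, D₂⁆ D₃ + ω.eval ⁅D₁, D₃⁆ D₂ - ω.eval ⁅D₂, D₃⁆ D₁

lemma eval_zero_left (ω : TwoForm k B) (D : Derivation k B B) : ω.eval 0 D = 0 := by
  simpa using eval_smul_left ω 0 0 D

lemma eval_zero_right (ω : TwoForm k B) (D : Derivation k B B) : ω.eval D 0 = 0 := by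
  simpa using eval_smul_right ω 0 D 0

lemma eval_neg_left (ω : TwoForm k B) (D E : Derivation k B B) :
    ω.eval (-D) E = -ω.eval D E := by
  simpa using eval_smul_left ω (-1) D E

lemma eval_neg (ω : TwoForm k B) (D E : Derivation k B B) : (-ω).eval D E = -ω.eval D E :=
  map_neg _ _

lemma extDeriv_swap_left (D₁ D₂ D₃ : Derivation k B B) :
    ω.extDeriv D₁ D₂ D₃ = -ω.extDeriv D₂ D₁ D₃ := by
  rw [extDeriv, extDeriv, ← lie_skew D₁ D₂, eval_neg_left, eval_swap ω D₁ D₂, map_neg]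
  ring

lemma extDeriv_swap_right (D₁ D₂ D₃ : Derivation k B B) :
    ω.extDeriv D₁ D₂ D₃ = -ω.extDeriv D₁ D₃ D₂ := by
  rw [extDeriv, extDeriv, ← lie_skew D₂ D₃, eval_neg_left, eval_swap ω D₂ D₃, map_neg]
  ring

lemma extDeriv_zero_left (D₂ D₃ : Derivation k B B) : ω.extDeriv 0 D₂ D₃ = 0 := by
  simp [extDeriv, eval_zero_left, eval_zero_right]

lemma extDeriv_add_left (D D' D₂ D₃ : Derivation k B B) :
    ω.extDeriv (D + D') D₂ D₃ = ω.extDeriv D D₂ D₃ + ω.extDeriv D' D₂ D₃ := by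
  simp only [extDeriv, add_lie, eval_add_left, eval_add_right, map_add, Derivation.add_apply]
  ring

/-- The derivatives of `b` produced by the Leibniz rule cancel against those in ⁅bD, E⁆ = b⁅D, E⁆ -
E(b)D. Thus dω is tensorial although its separate terms are not. -/
lemma extDeriv_smul_left (b : B) (D D₂ D₃ : Derivation k B B) :
    ω.extDeriv (b • D) D₂ D₃ = b * ω.extDeriv D D₂ D₃ := by
  have h : ∀ E : Derivation k B B, ⁅b • D, E⁆ = b • ⁅D, E⁆ + (-E b) • D := by
    intro E
    ext a
    simp only [Derivation.commutator_apply, Derivation.smul_apply, Derivation.add_apply,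
      smul_eq_mul, Derivation.leibniz]
    ring
  simp only [extDeriv, h, eval_add_left, eval_smul_left, eval_smul_right, Derivation.smul_apply,
    smul_eq_mul, Derivation.leibniz]
  ring

/-- To check that a 2-form is closed, generators of the module of vector fields suffice. -/
lemma isClosed_of_span {s : Set (Derivation k B B)} (hs : Submodule.span B s = ⊤)
    (h : ∀ D₁ ∈ s, ∀ D₂ ∈ s, ∀ D₃ ∈ s, ω.extDeriv D₁ D₂ D₃ = 0) : ω.IsClosed := by
  -- Passes from `s` to all fields in the first slot while a condition `P` holds on the other two.
  -- It is applied three times, with skew-symmetry bringing a new slot to the front.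
  have step : ∀ (P : Derivation k B B → Derivation k B B → Prop),
      (∀ D ∈ s, ∀ D₂ D₃, P D₂ D₃ → ω.extDeriv D D₂ D₃ = 0) →
      ∀ D D₂ D₃, P D₂ D₃ → ω.extDeriv D D₂ D₃ = 0 := by
    intro P hP D D₂ D₃ h23
    have hD : D ∈ Submodule.span B s := hs ▸ trivial
    induction hD using Submodule.span_induction with
    | mem D hD => exact hP D hD D₂ D₃ h23
    | zero => exact extDeriv_zero_left _ _
    | add D E _ _ hD hE => rw [extDeriv_add_left, hD, hE, add_zero]
    | smul b D _ hD => rw [extDeriv_smul_left, hD, mul_zero]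
  have h1 : ∀ D D₂ D₃, D₂ ∈ s ∧ D₃ ∈ s → ω.extDeriv D D₂ D₃ = 0 :=
    step (fun D₂ D₃ => D₂ ∈ s ∧ D₃ ∈ s) fun D hD D₂ D₃ h23 => h D hD D₂ h23.1 D₃ h23.2
  have h2 : ∀ D D₂ D₃, D₃ ∈ s → ω.extDeriv D D₂ D₃ = 0 :=
    step (fun D₂ D₃ => D₃ ∈ s) fun D hD D₂ D₃ h3 => by
      rw [extDeriv_swap_left, h1 _ _ _ ⟨hD, h3⟩, neg_zero]
  have h3 : ∀ D D₂ D₃, True → ω.extDeriv D D₂ D₃ = 0 :=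
    step (fun _ _ => True) fun D hD D₂ D₃ _ => by
      rw [extDeriv_swap_left, extDeriv_swap_right, h2 _ _ _ hD, neg_zero, neg_zero]
  exact fun D₁ D₂ D₃ => h3 D₁ D₂ D₃ trivial

lemma IsSymplectic.neg (h : ω.IsSymplectic) : (-ω).IsSymplectic := by
  refine ⟨fun D₁ D₂ D₃ => ?_, IsNondegenerate.neg h.nondegenerate⟩
  have := h.closed D₁ D₂ D₃
  simp only [eval_neg, map_neg]
  linear_combination -this

end Closed

end TwoForm

end Hamiltonian

/-! ### Symplectic forms on products. -/

section ProductForm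

open Algebra.TensorProduct

variable {k : Type v} [Field k] {B : Type u} [CommRing B] [Algebra k B]
  {C : Type u} [CommRing C] [Algebra k C]

/-- A vector field on `Spec B`, as a vector field on `Spec B × Spec C`. -/
def derivationLeft (C : Type u) [CommRing C] [Algebra k C] (D : Derivation k B B) :
    Derivation k (B ⊗[k] C) (B ⊗[k] C) :=
  Derivation.mk' (LinearMap.rTensor C (D : B →ₗ[k] B)) fun x y => by
    induction x with
    | zero => simp
    | add x x' hx hx' => rw [add_mul, map_add, hx, hx', map_add, smul_add, add_smul]; abel
    | tmul b c =>
      induction y with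
      | zero => simp
      | add y y' hy hy' => rw [mul_add, map_add, hy, hy', map_add, smul_add, add_smul]; abel
      | tmul b' c' =>
        simp [TensorProduct.add_tmul, mul_comm c c']

/-- A vector field on `Spec C`, as a vector field on `Spec B × Spec C`. -/
def derivationRight (B : Type u) [CommRing B] [Algebra k B] (D : Derivation k C C) :
    Derivation k (B ⊗[k] C) (B ⊗[k] C) :=
  Derivation.mk' (LinearMap.lTensor B (D : C →ₗ[k] C)) fun x y => by
    induction x with
    | zero => simp
    | add x x' hx hx' => rw [add_mul, map_add, hx, hx', map_add, smul_add, add_smul]; abel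
    | tmul b c =>
      induction y with
      | zero => simp
      | add y y' hy hy' => rw [mul_add, map_add, hy, hy', map_add, smul_add, add_smul]; abel
      | tmul b' c' =>
        simp [TensorProduct.tmul_add, mul_comm b b']

@[simp] lemma derivationLeft_tmul (D : Derivation k B B) (b : B) (c : C) :
    derivationLeft C D (b ⊗ₜ c) = D b ⊗ₜ c := rfl

@[simp] lemma derivationRight_tmul (D : Derivation k C C) (b : B) (c : C) :
    derivationRight B D (b ⊗ₜ c) = b ⊗ₜ D c := rfl

lemma derivation_tensor_ext {D E : Derivation k (B ⊗[k] C) (B ⊗[k] C)}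
    (h : ∀ b c, D (b ⊗ₜ c) = E (b ⊗ₜ c)) : D = E := by
  ext x
  induction x with
  | zero => simp
  | add x y hx hy => simp [hx, hy]
  | tmul b c => exact h b c

lemma lie_derivationLeft (D E : Derivation k B B) :
    ⁅derivationLeft C D, derivationLeft C E⁆ = derivationLeft C ⁅D, E⁆ := by
  apply derivation_tensor_ext
  intro b c
  simp [Derivation.commutator_apply, TensorProduct.sub_tmul]

lemma lie_derivationRight (D E : Derivation k C C) :
    ⁅derivationRight B D, derivationRight B E⁆ = derivationRight B ⁅D, E⁆ := by
  apply derivation_tensor_ext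
  intro b c
  simp [Derivation.commutator_apply, TensorProduct.tmul_sub]

lemma lie_derivationLeft_right (D : Derivation k B B) (E : Derivation k C C) :
    ⁅derivationLeft C D, derivationRight B E⁆ = 0 := by
  apply derivation_tensor_ext
  intro b c
  simp [Derivation.commutator_apply]

lemma lie_derivationRight_left (D : Derivation k B B) (E : Derivation k C C) :
    ⁅derivationRight B E, derivationLeft C D⁆ = 0 := by
  apply derivation_tensor_ext
  intro b c
  simp [Derivation.commutator_apply]

namespace TwoForm

variable {ω : TwoForm k B} {η : TwoForm k C}

/-- `derivationLeft C D` is related to `D` under the first projection and to the zero field under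
the second, so only ω contributes. -/
lemma eval_prod_left (D E : Derivation k B B) :
    (ω.prod η).eval (derivationLeft C D) (derivationLeft C E) = ω.eval D E ⊗ₜ 1 := by
  rw [TwoForm.prod, eval_add, eval_pullback (includeLeft : B →ₐ[k] B ⊗[k] C) ω D E,
    eval_pullback (includeRight : C →ₐ[k] B ⊗[k] C) η 0 0,
    eval_zero_left] <;> simp

lemma eval_prod_right (D E : Derivation k C C) :
    (ω.prod η).eval (derivationRight B D) (derivationRight B E) = 1 ⊗ₜ η.eval D E := by
  rw [TwoForm.prod, eval_add, eval_pullback (includeLeft : B →ₐ[k] B ⊗[k] C) ω 0 0,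
    eval_pullback (includeRight : C →ₐ[k] B ⊗[k] C) η D E,
    eval_zero_left] <;> simp

lemma eval_prod_left_right (D : Derivation k B B) (E : Derivation k C C) :
    (ω.prod η).eval (derivationLeft C D) (derivationRight B E) = 0 := by
  rw [TwoForm.prod, eval_add, eval_pullback (includeLeft : B →ₐ[k] B ⊗[k] C) ω D 0,
    eval_pullback (includeRight : C →ₐ[k] B ⊗[k] C) η 0 E,
    eval_zero_left, eval_zero_right] <;> simp

lemma eval_prod_right_left (D : Derivation k B B) (E : Derivation k C C) :
    (ω.prod η).eval (derivationRight B E) (derivationLeft C D) = 0 := by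
  rw [eval_swap, eval_prod_left_right, neg_zero]

lemma contract_prod_left {D : Derivation k B B} {b : B}
    (h : ω.contract D = KaehlerDifferential.D k B b) :
    (ω.prod η).contract (derivationLeft C D) = KaehlerDifferential.D k (B ⊗[k] C) (b ⊗ₜ 1) := by
  rw [TwoForm.prod, contract_add,
    contract_pullback (includeLeft : B →ₐ[k] B ⊗[k] C) ω D _ (by simp) h,
    contract_pullback_eq_zero _ _ _ (by simp)]
  simp

lemma contract_prod_right {D : Derivation k C C} {c : C}
    (h : η.contract D = KaehlerDifferential.D k C c) :
    (ω.prod η).contract (derivationRight B D) = KaehlerDifferential.D k (B ⊗[k] C) (1 ⊗ₜ c) := by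
  rw [TwoForm.prod, contract_add,
    contract_pullback (includeRight : C →ₐ[k] B ⊗[k] C) η D _ (by simp) h,
    contract_pullback_eq_zero _ _ _ (by simp)]
  simp

/-- Hamiltonian fields of the factors contract to d(b ⊗ 1) and d(1 ⊗ c), and these generate the
1-forms by Leibniz. Phrased as the image of a span, the result serves twice: for surjectivity of
contraction, and for the generation of vector fields. -/
lemma map_flat_prod_eq_top (hω : ω.IsNondegenerate) (hη : η.IsNondegenerate) :
    (Submodule.span (B ⊗[k] C) (Set.range (derivationLeft (k := k) (B := B) C) ∪
      Set.range (derivationRight (k := k) (C := C) B))).map (ω.prod η).flat = ⊤ := by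
  rw [eq_top_iff, ← KaehlerDifferential.span_range_derivation, Submodule.span_le]
  rintro _ ⟨x, rfl⟩
  rw [SetLike.mem_coe]
  induction x with
  | zero => rw [map_zero]; exact zero_mem _
  | add x y hx hy => rw [map_add]; exact add_mem hx hy
  | tmul b c =>
    rw [show b ⊗ₜ[k] c = (b ⊗ₜ 1) * (1 ⊗ₜ c) by simp, Derivation.leibniz]
    refine add_mem (Submodule.smul_mem _ _ ?_) (Submodule.smul_mem _ _ ?_)
    · exact ⟨_, Submodule.subset_span (Or.inr ⟨η.hamiltonianField c, rfl⟩),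
        contract_prod_right (hη.contract_hamiltonianField c)⟩
    · exact ⟨_, Submodule.subset_span (Or.inl ⟨ω.hamiltonianField b, rfl⟩),
        contract_prod_left (hω.contract_hamiltonianField b)⟩

lemma IsNondegenerate.prod (hω : ω.IsNondegenerate) (hη : η.IsNondegenerate) :
    (ω.prod η).IsNondegenerate := by
  refine contract_bijective_of_surjective fun α => ?_
  have hα : α ∈ (⊤ : Submodule (B ⊗[k] C) Ω[(B ⊗[k] C)⁄k]) := trivial
  rw [← map_flat_prod_eq_top hω hη] at hα
  obtain ⟨D, -, hD⟩ := hα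
  exact ⟨D, hD⟩

/-- Contraction is injective and already maps this span onto all 1-forms, so the span is everything.
No finiteness of `B` or `C` enters. -/
lemma span_derivation_prod (hω : ω.IsNondegenerate) (hη : η.IsNondegenerate) :
    Submodule.span (B ⊗[k] C) (Set.range (derivationLeft (k := k) (B := B) C) ∪
      Set.range (derivationRight (k := k) (C := C) B)) = ⊤ := by
  refine Submodule.map_injective_of_injective (f := (ω.prod η).flat) (hω.prod hη).1 ?_
  rw [map_flat_prod_eq_top hω hη, Submodule.map_top, LinearMap.range_eq_top.2 (hω.prod hη).2]

lemma IsSymplectic.prod (hω : ω.IsSymplectic) (hη : η.IsSymplectic) :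
    (ω.prod η).IsSymplectic := by
  refine ⟨isClosed_of_span (span_derivation_prod hω.nondegenerate hη.nondegenerate) ?_,
    IsNondegenerate.prod hω.nondegenerate hη.nondegenerate⟩
  rintro _ (⟨D₁, rfl⟩ | ⟨D₁, rfl⟩) _ (⟨D₂, rfl⟩ | ⟨D₂, rfl⟩) _ (⟨D₃, rfl⟩ | ⟨D₃, rfl⟩)
  · have := congrArg (fun b : B => b ⊗ₜ[k] (1 : C)) (hω.closed D₁ D₂ D₃)
    simpa [extDeriv, lie_derivationLeft, eval_prod_left, TensorProduct.add_tmul,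
      TensorProduct.sub_tmul] using this
  -- In the mixed triples every term vanishes: fields from different factors commute and are
  -- orthogonal, and a field of one factor kills functions of the other. Only the triple of right
  -- fields is left, where closedness of η is needed.
  all_goals
    try simp [extDeriv, lie_derivationLeft, lie_derivationRight, lie_derivationRight_left,
      lie_derivationLeft_right, eval_prod_left, eval_prod_right, eval_prod_left_right,
      eval_prod_right_left, eval_zero_left]
  have := congrArg (fun c : C => (1 : B) ⊗ₜ[k] c) (hη.closed D₁ D₂ D₃)
  simpa [TensorProduct.tmul_add, TensorProduct.tmul_sub] using this

lemma hamiltonianField_prod_left (hω : ω.IsNondegenerate) (hη : η.IsNondegenerate) (b : B) :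
    (ω.prod η).hamiltonianField (b ⊗ₜ 1) = derivationLeft C (ω.hamiltonianField b) :=
  (hω.prod hη).hamiltonianField_eq (contract_prod_left (hω.contract_hamiltonianField b))

lemma hamiltonianField_prod_right (hω : ω.IsNondegenerate) (hη : η.IsNondegenerate) (c : C) :
    (ω.prod η).hamiltonianField (1 ⊗ₜ c) = derivationRight B (η.hamiltonianField c) :=
  (hω.prod hη).hamiltonianField_eq (contract_prod_right (hη.contract_hamiltonianField c))

lemma bracket_prod_tmul (hω : ω.IsNondegenerate) (hη : η.IsNondegenerate) (b b' : B) (c c' : C) :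
    (ω.prod η).bracket (b ⊗ₜ c) (b' ⊗ₜ c') =
      ω.bracket b b' ⊗ₜ (c * c') + (b * b') ⊗ₜ η.bracket c c' := by
  rw [TwoForm.bracket, show b' ⊗ₜ[k] c' = (b' ⊗ₜ 1) * (1 ⊗ₜ c') by simp,
    (hω.prod hη).hamiltonianField_mul, hamiltonianField_prod_left hω hη,
    hamiltonianField_prod_right hω hη]
  simp [TwoForm.bracket, mul_comm, add_comm]

end TwoForm

end ProductForm

open Algebra.TensorProduct

/-! ### Poisson brackets under morphisms, and coisotropy of generated ideals. -/

section BracketMaps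

variable {k : Type v} [Field k]
  {B B' C C' : Type u} [CommRing B] [Algebra k B] [CommRing B'] [Algebra k B']
  [CommRing C] [Algebra k C] [CommRing C'] [Algebra k C']
  {ω : TwoForm k B} {ω' : TwoForm k B'} {η : TwoForm k C} {η' : TwoForm k C'}

namespace TwoForm

/-- `φ` multiplies Poisson brackets by the constant `ε`. -/
def ScalesBracket (ω : TwoForm k B) (ω' : TwoForm k B') (ε : k) (φ : B →ₐ[k] B') : Prop :=
  ∀ f g, ω'.bracket (φ f) (φ g) = ε • φ (ω.bracket f g)

lemma ScalesBracket.neg (hω : ω.IsNondegenerate) (hω' : ω'.IsNondegenerate) {ε : k}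
    {φ : B →ₐ[k] B'} (h : ScalesBracket ω ω' ε φ) : ScalesBracket (-ω) (-ω') ε φ := by
  intro f g
  rw [hω'.bracket_neg, hω.bracket_neg, h, map_neg, smul_neg]

lemma ScalesBracket.map (hω : ω.IsNondegenerate) (hω' : ω'.IsNondegenerate)
    (hη : η.IsNondegenerate) (hη' : η'.IsNondegenerate) {ε : k}
    {φ : B →ₐ[k] B'} {ψ : C →ₐ[k] C'} (hφ : ScalesBracket ω ω' ε φ)
    (hψ : ScalesBracket η η' ε ψ) :
    ScalesBracket (ω.prod η) (ω'.prod η') ε (Algebra.TensorProduct.map φ ψ) := by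
  intro x y
  have h := hω.prod hη
  have h' := hω'.prod hη'
  induction x with
  | zero => simp only [map_zero, bracket_zero_left, smul_zero]
  | add x x' hx hx' => simp only [map_add, bracket_add_left, hx, hx', smul_add]
  | tmul b c =>
    induction y with
    | zero => simp only [map_zero, h.bracket_zero_right, h'.bracket_zero_right, smul_zero]
    | add y y' hy hy' =>
      simp only [map_add, h.bracket_add_right, h'.bracket_add_right, hy, hy', smul_add]
    | tmul b' c' =>
      simp only [map_tmul, bracket_prod_tmul hω hη, bracket_prod_tmul hω' hη', hφ b b', hψ c c',
        map_add, map_mul, smul_add, TensorProduct.smul_tmul', TensorProduct.tmul_smul]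

/-- On pure tensors each term of the bracket contains one of the vanishing brackets. Used twice in
succession, it passes from Poisson commuting maps to their threefold products. -/
lemma bracket_map_map_eq_zero (hω' : ω'.IsNondegenerate) (hη' : η'.IsNondegenerate)
    {B₁ C₁ : Type u} [CommRing B₁] [Algebra k B₁] [CommRing C₁] [Algebra k C₁]
    {φ : B →ₐ[k] B'} {ψ : C →ₐ[k] C'} {φ₁ : B₁ →ₐ[k] B'} {ψ₁ : C₁ →ₐ[k] C'}
    (hφ : ∀ f g, ω'.bracket (φ f) (φ₁ g) = 0) (hψ : ∀ f g, η'.bracket (ψ f) (ψ₁ g) = 0)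
    (x : B ⊗[k] C) (y : B₁ ⊗[k] C₁) :
    (ω'.prod η').bracket (map φ ψ x) (map φ₁ ψ₁ y) = 0 := by
  have h' := hω'.prod hη'
  induction x with
  | zero => simp only [map_zero, bracket_zero_left]
  | add x x' hx hx' => simp only [map_add, bracket_add_left, hx, hx', add_zero]
  | tmul b c =>
    induction y with
    | zero => simp only [map_zero, h'.bracket_zero_right]
    | add y y' hy hy' => simp only [map_add, h'.bracket_add_right, hy, hy', add_zero]
    | tmul b' c' =>
      simp only [map_tmul, bracket_prod_tmul hω' hη', hφ b b', hψ c c', TensorProduct.zero_tmul,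
        TensorProduct.tmul_zero, add_zero]

lemma bracket_one_right (hω : ω.IsNondegenerate) (f : B) : ω.bracket f 1 = 0 := by
  rw [hω.bracket_swap, TwoForm.bracket, Derivation.map_one_eq_zero, neg_zero]

lemma bracket_one_left (f : B) : ω.bracket 1 f = 0 := Derivation.map_one_eq_zero _

lemma bracket_includeLeft (hω : ω.IsNondegenerate) (hη : η.IsNondegenerate) (f g : B) :
    (ω.prod η).bracket ((includeLeft : B →ₐ[k] B ⊗[k] C) f)
      ((includeLeft : B →ₐ[k] B ⊗[k] C) g) =
      (includeLeft : B →ₐ[k] B ⊗[k] C) (ω.bracket f g) := by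
  simp [bracket_prod_tmul hω hη, bracket_one_left]

lemma bracket_includeRight (hω : ω.IsNondegenerate) (hη : η.IsNondegenerate) (f g : C) :
    (ω.prod η).bracket ((includeRight : C →ₐ[k] B ⊗[k] C) f)
      ((includeRight : C →ₐ[k] B ⊗[k] C) g) =
      (includeRight : C →ₐ[k] B ⊗[k] C) (η.bracket f g) := by
  simp [bracket_prod_tmul hω hη, bracket_one_left]

lemma bracket_includeLeft_includeRight (hω : ω.IsNondegenerate) (hη : η.IsNondegenerate)
    (f : B) (g : C) :
    (ω.prod η).bracket ((includeLeft : B →ₐ[k] B ⊗[k] C) f)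
      ((includeRight : C →ₐ[k] B ⊗[k] C) g) = 0 := by
  simp [bracket_prod_tmul hω hη, bracket_one_left, bracket_one_right hω]

variable {D : Type u} [CommRing D] [Algebra k D] {θ : TwoForm k D}

/-- The form on `G × G × G⁻`. -/
abbrev triple (ω : TwoForm k B) : TwoForm k ((B ⊗[k] B) ⊗[k] B) := (ω.prod ω).prod (-ω)

lemma IsNondegenerate.triple (h : ω.IsNondegenerate) : ω.triple.IsNondegenerate :=
  (h.prod h).prod h.neg

lemma ScalesBracket.triple (hω : ω.IsNondegenerate) (hω' : ω'.IsNondegenerate) {ε : k}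
    {φ : B →ₐ[k] B'} (h : ScalesBracket ω ω' ε φ) :
    ScalesBracket ω.triple ω'.triple ε
      (Algebra.TensorProduct.map (Algebra.TensorProduct.map φ φ) φ) :=
  (h.map hω hω' hω hω' h).map (hω.prod hω) (hω'.prod hω') hω.neg hω'.neg (h.neg hω hω')

/-- The bracket of two generators of the same kind is a constant times such a generator, and
generators of different kinds commute. -/
lemma isCoisotropic_span_triple (hω : ω.IsNondegenerate) (hη : η.IsNondegenerate)
    (hθ : θ.IsNondegenerate) {ε ε' : k} {φ : B →ₐ[k] D} {ψ : C →ₐ[k] D}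
    (hφ : ScalesBracket ω θ ε φ) (hψ : ScalesBracket η θ ε' ψ)
    (hφψ : ∀ f g, θ.bracket (φ f) (ψ g) = 0)
    {I : Ideal ((B ⊗[k] B) ⊗[k] B)} {J : Ideal ((C ⊗[k] C) ⊗[k] C)}
    (hI : ω.triple.IsCoisotropic I) (hJ : η.triple.IsCoisotropic J) :
    θ.triple.IsCoisotropic (Ideal.span (Algebra.TensorProduct.map
      (Algebra.TensorProduct.map φ φ) φ '' I ∪ Algebra.TensorProduct.map
      (Algebra.TensorProduct.map ψ ψ) ψ '' J)) := by
  have hφψ' : ∀ f g, (-θ).bracket (φ f) (ψ g) = 0 := fun f g => by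
    rw [hθ.bracket_neg, hφψ, neg_zero]
  have h3 := bracket_map_map_eq_zero (hθ.prod hθ) hθ.neg
    (bracket_map_map_eq_zero hθ hθ hφψ hφψ) hφψ'
  refine hθ.triple.isCoisotropic_span ?_
  rintro _ (⟨x, hx, rfl⟩ | ⟨x, hx, rfl⟩) _ (⟨y, hy, rfl⟩ | ⟨y, hy, rfl⟩)
  · rw [hφ.triple hω hθ x y, Algebra.smul_def]
    exact Ideal.mul_mem_left _ _ (Ideal.subset_span (Or.inl ⟨_, hI x hx y hy, rfl⟩))
  · rw [h3 x y]
    exact zero_mem _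
  · rw [hθ.triple.bracket_swap, h3 y x, neg_zero]
    exact zero_mem _
  · rw [hψ.triple hη hθ x y, Algebra.smul_def]
    exact Ideal.mul_mem_left _ _ (Ideal.subset_span (Or.inr ⟨_, hJ x hx y hy, rfl⟩))

end TwoForm

end BracketMaps

/-! ### Points of the graph of multiplication. -/

/-- An ideal is determined by the points that it contains. -/
lemma ideal_eq_of_le_ker_iff {k : Type v} [Field k] {B : Type u} [CommRing B] [Algebra k B]
    {I J : Ideal B} (h : ∀ {R : Type u} [CommRing R] [Algebra k R] (φ : B →ₐ[k] R),
      I ≤ RingHom.ker φ ↔ J ≤ RingHom.ker φ) : I = J := by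
  have hk : ∀ K : Ideal B, RingHom.ker (Ideal.Quotient.mkₐ k K) = K := fun K => by
    ext x; exact Ideal.Quotient.eq_zero_iff_mem
  apply le_antisymm
  · simpa only [hk] using (h (Ideal.Quotient.mkₐ k J)).2 (hk J).ge
  · simpa only [hk] using (h (Ideal.Quotient.mkₐ k I)).1 (hk I).ge

section Graph

variable {k : Type v} [Field k]
variable {A : Type u} [CommRing A] [Algebra k A] {B : Type u} [CommRing B] [Algebra k B]
variable {R : Type u} [CommRing R] [Algebra k R]

/-- The comorphism of the first projection of `G × G × G`. -/
def leg₁ : B →ₐ[k] (B ⊗[k] B) ⊗[k] B := includeLeft.comp includeLeft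

/-- The comorphism of the second projection of `G × G × G`. -/
def leg₂ : B →ₐ[k] (B ⊗[k] B) ⊗[k] B := includeLeft.comp includeRight

/-- The comorphism of the third projection of `G × G × G`. -/
def leg₃ : B →ₐ[k] (B ⊗[k] B) ⊗[k] B := includeRight

lemma leg₁_apply (b : B) : leg₁ (k := k) b = (b ⊗ₜ 1) ⊗ₜ 1 := rfl
lemma leg₂_apply (b : B) : leg₂ (k := k) b = (1 ⊗ₜ b) ⊗ₜ 1 := rfl
lemma leg₃_apply (b : B) : leg₃ (k := k) b = (1 ⊗ₜ 1) ⊗ₜ b := rfl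

lemma triple_ext {φ ψ : (B ⊗[k] B) ⊗[k] B →ₐ[k] R} (h₁ : φ.comp leg₁ = ψ.comp leg₁)
    (h₂ : φ.comp leg₂ = ψ.comp leg₂) (h₃ : φ.comp leg₃ = ψ.comp leg₃) : φ = ψ :=
  tensor_ext (tensor_ext h₁ h₂) h₃

namespace AffineGroupoid

variable (Γ : AffineGroupoid k A B)

/-- The comorphism of `(g, h) ↦ (g, h, g h)`. -/
def graphHom : (B ⊗[k] B) ⊗[k] B →ₐ[k] Composable Γ.s Γ.t :=
  lift (Ideal.Quotient.mkₐ k (fibreIdeal Γ.s Γ.t)) Γ.mul (fun _ _ => Commute.all _ _)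

lemma mem_graphIdeal {x : (B ⊗[k] B) ⊗[k] B} : x ∈ Γ.graphIdeal ↔ Γ.graphHom x = 0 := Iff.rfl

lemma leg_sub_mem_graphIdeal (f : A) : leg₁ (Γ.s f) - leg₂ (Γ.t f) ∈ Γ.graphIdeal := by
  rw [mem_graphIdeal, graphHom, leg₁_apply, leg₂_apply, ← TensorProduct.sub_tmul, lift_tmul,
    map_one, mul_one]
  exact Ideal.Quotient.eq_zero_iff_mem.2 (Ideal.subset_span ⟨f, rfl⟩)

/-- On the graph the third component is a function of the first two: `m` extends `Γ.mul b` from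
composable pairs to all of G × G. -/
lemma exists_leg_sub_mem_graphIdeal (b : B) :
    ∃ m : B ⊗[k] B, Ideal.Quotient.mkₐ k (fibreIdeal Γ.s Γ.t) m = Γ.mul b ∧
      leg₃ b - m ⊗ₜ 1 ∈ Γ.graphIdeal := by
  obtain ⟨m, hm⟩ := Ideal.Quotient.mkₐ_surjective k (fibreIdeal Γ.s Γ.t) (Γ.mul b)
  refine ⟨m, hm, ?_⟩
  rw [mem_graphIdeal, graphHom, leg₃_apply, map_sub, lift_tmul, lift_tmul, map_one, mul_one, hm]
  rw [show (1 : B) ⊗ₜ[k] (1 : B) = 1 from rfl, map_one, one_mul, sub_self]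

lemma pairPoint_comp_graphHom {g h : B →ₐ[k] R} (hgh : g.comp Γ.s = h.comp Γ.t) :
    (pairPoint g h hgh).comp Γ.graphHom =
      lift (lift g h fun _ _ => Commute.all _ _) (compPoint Γ.mul g h hgh)
        (fun _ _ => Commute.all _ _) := by
  apply tensor_ext
  · rw [AlgHom.comp_assoc, graphHom, lift_comp_includeLeft, lift_comp_includeLeft]
    apply Algebra.TensorProduct.ext'
    intro a b
    rw [AlgHom.comp_apply, pairPoint_mk_tmul, lift_tmul]
  · rw [AlgHom.comp_assoc, graphHom, lift_right, lift_right, compPoint]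

/-- An `R`-point of `G × G × G` lies on the graph of multiplication if and only if it is of the form
`(g, h, g h)`. -/
lemma graphIdeal_le_ker_iff (φ : (B ⊗[k] B) ⊗[k] B →ₐ[k] R) :
    Γ.graphIdeal ≤ RingHom.ker φ ↔
      ∃ hgh : (φ.comp leg₁).comp Γ.s = (φ.comp leg₂).comp Γ.t,
        φ.comp leg₃ = compPoint Γ.mul (φ.comp leg₁) (φ.comp leg₂) hgh := by
  constructor
  · intro h
    have hgh : (φ.comp leg₁).comp Γ.s = (φ.comp leg₂).comp Γ.t := by
      ext f
      exact sub_eq_zero.1 ((map_sub φ _ _).symm.trans (h (Γ.leg_sub_mem_graphIdeal f)))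
    refine ⟨hgh, ?_⟩
    ext b
    obtain ⟨m, hm, hmem⟩ := Γ.exists_leg_sub_mem_graphIdeal b
    refine (sub_eq_zero.1 ((map_sub φ _ _).symm.trans (h hmem))).trans ?_
    rw [compPoint, AlgHom.comp_apply, ← hm]
    have : φ.comp includeLeft = (pairPoint (φ.comp leg₁) (φ.comp leg₂) hgh).comp
        (Ideal.Quotient.mkₐ k (fibreIdeal Γ.s Γ.t)) := by
      apply Algebra.TensorProduct.ext'
      intro a b
      refine Eq.trans ?_ (pairPoint_mk_tmul _ _ hgh a b).symm
      simp [leg₁_apply, leg₂_apply, ← map_mul]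
    exact DFunLike.congr_fun this m
  · rintro ⟨hgh, hl⟩ x hx
    have : φ = (pairPoint (φ.comp leg₁) (φ.comp leg₂) hgh).comp Γ.graphHom := by
      rw [pairPoint_comp_graphHom]
      apply triple_ext
      · ext b; simp [leg₁_apply]
      · ext b; simp [leg₂_apply]
      · rw [hl]; exact (lift_right _ _ _).symm
    rw [RingHom.mem_ker, this, AlgHom.comp_apply, Γ.mem_graphIdeal.1 hx, map_zero]

end AffineGroupoid

end Graph

/-! ### The graph of multiplication of a product groupoid. -/

section ProductGraph

variable {k : Type v} [Field k]
variable {A₁ : Type u} [CommRing A₁] [Algebra k A₁] {B₁ : Type u} [CommRing B₁] [Algebra k B₁]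
variable {A₂ : Type u} [CommRing A₂] [Algebra k A₂] {B₂ : Type u} [CommRing B₂] [Algebra k B₂]
variable {R : Type u} [CommRing R] [Algebra k R]

variable (k B₁ B₂) in
/-- The comorphism of `(G₁ × G₂)³ ⟶ G₁³`. -/
def tripleLeft : (B₁ ⊗[k] B₁) ⊗[k] B₁ →ₐ[k]
    ((B₁ ⊗[k] B₂) ⊗[k] (B₁ ⊗[k] B₂)) ⊗[k] (B₁ ⊗[k] B₂) :=
  map (map includeLeft includeLeft) includeLeft

variable (k B₁ B₂) in
/-- The comorphism of `(G₁ × G₂)³ ⟶ G₂³`. -/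
def tripleRight : (B₂ ⊗[k] B₂) ⊗[k] B₂ →ₐ[k]
    ((B₁ ⊗[k] B₂) ⊗[k] (B₁ ⊗[k] B₂)) ⊗[k] (B₁ ⊗[k] B₂) :=
  map (map includeRight includeRight) includeRight

lemma tripleLeft_comp_leg₁ :
    (tripleLeft k B₁ B₂).comp leg₁ = leg₁.comp (includeLeft : B₁ →ₐ[k] B₁ ⊗[k] B₂) := by
  ext b; simp [tripleLeft, leg₁_apply, Algebra.TensorProduct.one_def]
lemma tripleLeft_comp_leg₂ :
    (tripleLeft k B₁ B₂).comp leg₂ = leg₂.comp (includeLeft : B₁ →ₐ[k] B₁ ⊗[k] B₂) := by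
  ext b; simp [tripleLeft, leg₂_apply, Algebra.TensorProduct.one_def]
lemma tripleLeft_comp_leg₃ :
    (tripleLeft k B₁ B₂).comp leg₃ = leg₃.comp (includeLeft : B₁ →ₐ[k] B₁ ⊗[k] B₂) := by
  ext b; simp [tripleLeft, leg₃_apply, Algebra.TensorProduct.one_def]
lemma tripleRight_comp_leg₁ :
    (tripleRight k B₁ B₂).comp leg₁ = leg₁.comp (includeRight : B₂ →ₐ[k] B₁ ⊗[k] B₂) := by
  ext b; simp [tripleRight, leg₁_apply, Algebra.TensorProduct.one_def]
lemma tripleRight_comp_leg₂ :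
    (tripleRight k B₁ B₂).comp leg₂ = leg₂.comp (includeRight : B₂ →ₐ[k] B₁ ⊗[k] B₂) := by
  ext b; simp [tripleRight, leg₂_apply, Algebra.TensorProduct.one_def]
lemma tripleRight_comp_leg₃ :
    (tripleRight k B₁ B₂).comp leg₃ = leg₃.comp (includeRight : B₂ →ₐ[k] B₁ ⊗[k] B₂) := by
  ext b; simp [tripleRight, leg₃_apply, Algebra.TensorProduct.one_def]

namespace AffineGroupoid

variable (Γ₁ : AffineGroupoid k A₁ B₁) (Γ₂ : AffineGroupoid k A₂ B₂)

/-- A point lies on the graph of multiplication of a product if and only if its two components lie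
on the graphs of multiplication of the factors. -/
lemma graphIdeal_prod_le_ker_iff
    (φ : ((B₁ ⊗[k] B₂) ⊗[k] (B₁ ⊗[k] B₂)) ⊗[k] (B₁ ⊗[k] B₂) →ₐ[k] R) :
    (Γ₁.prod Γ₂).graphIdeal ≤ RingHom.ker φ ↔
      Γ₁.graphIdeal ≤ RingHom.ker (φ.comp (tripleLeft k B₁ B₂)) ∧
        Γ₂.graphIdeal ≤ RingHom.ker (φ.comp (tripleRight k B₁ B₂)) := by
  have hL₁ : (φ.comp (tripleLeft k B₁ B₂)).comp leg₁ = (φ.comp leg₁).comp includeLeft := by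
    rw [AlgHom.comp_assoc, tripleLeft_comp_leg₁, AlgHom.comp_assoc]
  have hL₂ : (φ.comp (tripleLeft k B₁ B₂)).comp leg₂ = (φ.comp leg₂).comp includeLeft := by
    rw [AlgHom.comp_assoc, tripleLeft_comp_leg₂, AlgHom.comp_assoc]
  have hL₃ : (φ.comp (tripleLeft k B₁ B₂)).comp leg₃ = (φ.comp leg₃).comp includeLeft := by
    rw [AlgHom.comp_assoc, tripleLeft_comp_leg₃, AlgHom.comp_assoc]
  have hR₁ : (φ.comp (tripleRight k B₁ B₂)).comp leg₁ = (φ.comp leg₁).comp includeRight := by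
    rw [AlgHom.comp_assoc, tripleRight_comp_leg₁, AlgHom.comp_assoc]
  have hR₂ : (φ.comp (tripleRight k B₁ B₂)).comp leg₂ = (φ.comp leg₂).comp includeRight := by
    rw [AlgHom.comp_assoc, tripleRight_comp_leg₂, AlgHom.comp_assoc]
  have hR₃ : (φ.comp (tripleRight k B₁ B₂)).comp leg₃ = (φ.comp leg₃).comp includeRight := by
    rw [AlgHom.comp_assoc, tripleRight_comp_leg₃, AlgHom.comp_assoc]
  simp only [graphIdeal_le_ker_iff, hL₁, hL₂, hL₃, hR₁, hR₂, hR₃]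
  constructor
  · rintro ⟨hgh, hl⟩
    refine ⟨⟨comp_left hgh, ?_⟩, ⟨comp_right hgh, ?_⟩⟩
    · exact (congrArg (fun ψ => AlgHom.comp ψ includeLeft) hl).trans
        (compPoint_prodMul_left Γ₁.mul Γ₂.mul _ _ hgh)
    · exact (congrArg (fun ψ => AlgHom.comp ψ includeRight) hl).trans
        (compPoint_prodMul_right Γ₁.mul Γ₂.mul _ _ hgh)
  · rintro ⟨⟨h₁, hl₁⟩, ⟨h₂, hl₂⟩⟩
    have hgh : (φ.comp leg₁).comp (map Γ₁.s Γ₂.s) = (φ.comp leg₂).comp (map Γ₁.t Γ₂.t) := by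
      apply tensor_ext
      · rw [comp_map_left, comp_map_left]; exact h₁
      · rw [comp_map_right, comp_map_right]; exact h₂
    refine ⟨hgh, ?_⟩
    apply tensor_ext
    · exact hl₁.trans (compPoint_prodMul_left Γ₁.mul Γ₂.mul _ _ hgh).symm
    · exact hl₂.trans (compPoint_prodMul_right Γ₁.mul Γ₂.mul _ _ hgh).symm

/-- By the Yoneda principle: both ideals vanish at exactly the same points with values in any
algebra. -/
lemma graphIdeal_prod :
    (Γ₁.prod Γ₂).graphIdeal = Ideal.span (tripleLeft k B₁ B₂ '' Γ₁.graphIdeal ∪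
      tripleRight k B₁ B₂ '' Γ₂.graphIdeal) := by
  refine ideal_eq_of_le_ker_iff (k := k) fun φ => ?_
  rw [graphIdeal_prod_le_ker_iff, Ideal.span_le, Set.union_subset_iff, Set.image_subset_iff,
    Set.image_subset_iff]
  rfl

/-- The graph of multiplication of `G₁⁻ × G₂` is coisotropic if those of `G₁` and `G₂` are. -/
lemma isCoisotropic_graphIdeal_prod {ω₁ : TwoForm k B₁} {ω₂ : TwoForm k B₂}
    (h₁ : ω₁.IsNondegenerate) (h₂ : ω₂.IsNondegenerate)
    (hc₁ : ω₁.triple.IsCoisotropic Γ₁.graphIdeal) (hc₂ : ω₂.triple.IsCoisotropic Γ₂.graphIdeal) :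
    ((-ω₁).prod ω₂).triple.IsCoisotropic (Γ₁.prod Γ₂).graphIdeal := by
  -- The scale -1 comes from G₁⁻. An ideal absorbs this constant, so both factors are treated by the
  -- same lemma.
  have hL : TwoForm.ScalesBracket ω₁ ((-ω₁).prod ω₂) (-1 : k) includeLeft := fun f g => by
    rw [TwoForm.bracket_includeLeft h₁.neg h₂, h₁.bracket_neg, map_neg, neg_smul, one_smul]
  have hR : TwoForm.ScalesBracket ω₂ ((-ω₁).prod ω₂) (1 : k) includeRight := fun f g => by
    rw [TwoForm.bracket_includeRight h₁.neg h₂, one_smul]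
  rw [graphIdeal_prod]
  exact TwoForm.isCoisotropic_span_triple h₁ h₂ (h₁.neg.prod h₂) hL hR
    (TwoForm.bracket_includeLeft_includeRight h₁.neg h₂) hc₁ hc₂

end AffineGroupoid

end ProductGraph

/-! ### Smoothness of products. -/

section Smooth

variable {k : Type v} [Field k]
variable {A₁ : Type u} [CommRing A₁] [Algebra k A₁] {B₁ : Type u} [CommRing B₁] [Algebra k B₁]
variable {A₂ : Type u} [CommRing A₂] [Algebra k A₂] {B₂ : Type u} [CommRing B₂] [Algebra k B₂]

/-- Up to the isomorphism (A₁ ⊗ C) ⊗_{A₁} B₁ ≅ B₁ ⊗ C this is the base change of `φ` along A₁ → A₁ ⊗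
C. -/
lemma smooth_map_id {φ : A₁ →ₐ[k] B₁} (hφ : (φ : A₁ →+* B₁).Smooth) (C : Type u) [CommRing C]
    [Algebra k C] : (map φ (AlgHom.id k C) : A₁ ⊗[k] C →+* B₁ ⊗[k] C).Smooth := by
  let _ : Algebra A₁ B₁ := φ.toAlgebra
  have : IsScalarTower k A₁ B₁ := IsScalarTower.of_algebraMap_eq' φ.comp_algebraMap.symm
  have : Algebra.Smooth A₁ B₁ := hφ
  let e : (A₁ ⊗[k] C) ⊗[A₁] B₁ ≃+* B₁ ⊗[k] C :=
    (Algebra.TensorProduct.comm A₁ (A₁ ⊗[k] C) B₁).toRingEquiv.trans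
      (cancelBaseChange k A₁ B₁ B₁ C).toRingEquiv
  have h : (map φ (AlgHom.id k C) : A₁ ⊗[k] C →+* B₁ ⊗[k] C) =
      (e : (A₁ ⊗[k] C) ⊗[A₁] B₁ →+* B₁ ⊗[k] C).comp
        (algebraMap (A₁ ⊗[k] C) ((A₁ ⊗[k] C) ⊗[A₁] B₁)) := by
    apply RingHom.ext
    intro x
    induction x with
    | zero => simp
    | add x y hx hy => rw [map_add, map_add, hx, hy]
    | tmul a c =>
      change φ a ⊗ₜ[k] c = (cancelBaseChange k A₁ B₁ B₁ C) (1 ⊗ₜ[A₁] (a ⊗ₜ[k] c))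
      rw [cancelBaseChange_tmul, Algebra.smul_def, mul_one]
      rfl
  rw [h]
  exact ((RingHom.smooth_algebraMap).2 inferInstance).comp (.of_bijective e.bijective)

lemma smooth_id_map {φ : A₂ →ₐ[k] B₂} (hφ : (φ : A₂ →+* B₂).Smooth) (C : Type u) [CommRing C]
    [Algebra k C] : (map (AlgHom.id k C) φ : C ⊗[k] A₂ →+* C ⊗[k] B₂).Smooth := by
  have h : (map (AlgHom.id k C) φ : C ⊗[k] A₂ →+* C ⊗[k] B₂) =
      ((Algebra.TensorProduct.comm k B₂ C : B₂ ⊗[k] C →+* C ⊗[k] B₂).comp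
        (map φ (AlgHom.id k C) : A₂ ⊗[k] C →+* B₂ ⊗[k] C)).comp
        (Algebra.TensorProduct.comm k C A₂ : C ⊗[k] A₂ →+* A₂ ⊗[k] C) := by
    apply RingHom.ext
    intro x
    induction x with
    | zero => simp
    | add x y hx hy => rw [map_add, map_add, hx, hy]
    | tmul a c => rfl
  rw [h]
  exact (RingHom.Smooth.of_bijective (Algebra.TensorProduct.comm k C A₂).bijective).comp
    ((smooth_map_id hφ C).comp
      (RingHom.Smooth.of_bijective (Algebra.TensorProduct.comm k B₂ C).bijective))

lemma smooth_map {φ : A₁ →ₐ[k] B₁} {ψ : A₂ →ₐ[k] B₂} (hφ : (φ : A₁ →+* B₁).Smooth)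
    (hψ : (ψ : A₂ →+* B₂).Smooth) : (map φ ψ : A₁ ⊗[k] A₂ →+* B₁ ⊗[k] B₂).Smooth := by
  have h : (map φ ψ : A₁ ⊗[k] A₂ →+* B₁ ⊗[k] B₂) =
      (map (AlgHom.id k B₁) ψ : B₁ ⊗[k] A₂ →+* B₁ ⊗[k] B₂).comp
        (map φ (AlgHom.id k A₂) : A₁ ⊗[k] A₂ →+* B₁ ⊗[k] A₂) := by
    apply RingHom.ext
    intro x
    induction x with
    | zero => simp
    | add x y hx hy => rw [map_add, map_add, hx, hy]
    | tmul a c => rfl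
  rw [h]
  exact (smooth_map_id hφ A₂).comp (smooth_id_map hψ B₁)

lemma smooth_tensorProduct [Algebra.Smooth k A₁] [Algebra.Smooth k A₂] :
    Algebra.Smooth k (A₁ ⊗[k] A₂) :=
  Algebra.Smooth.comp k A₁ (A₁ ⊗[k] A₂)

lemma AffineGroupoid.IsLie.prod {Γ₁ : AffineGroupoid k A₁ B₁} {Γ₂ : AffineGroupoid k A₂ B₂}
    (h₁ : Γ₁.IsLie) (h₂ : Γ₂.IsLie) : (Γ₁.prod Γ₂).IsLie where
  smooth_base :=
    have := h₁.smooth_base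
    have := h₂.smooth_base
    smooth_tensorProduct
  smooth_arrows :=
    have := h₁.smooth_arrows
    have := h₂.smooth_arrows
    smooth_tensorProduct
  smooth_s := smooth_map h₁.smooth_s h₂.smooth_s
  smooth_t := smooth_map h₁.smooth_t h₂.smooth_t

/-- The product `G₁⁻ × G₂` of two affine symplectic groupoids is an affine symplectic groupoid. -/
theorem AffineGroupoid.IsSymplectic.prod {Γ₁ : AffineGroupoid k A₁ B₁}
    {Γ₂ : AffineGroupoid k A₂ B₂} {ω₁ : TwoForm k B₁} {ω₂ : TwoForm k B₂}
    (h₁ : Γ₁.IsSymplectic ω₁) (h₂ : Γ₂.IsSymplectic ω₂) :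
    (Γ₁.prod Γ₂).IsSymplectic ((-ω₁).prod ω₂) where
  isLie := h₁.isLie.prod h₂.isLie
  symplectic := h₁.symplectic.neg.prod h₂.symplectic
  multiplicative := isCoisotropic_graphIdeal_prod Γ₁ Γ₂ h₁.symplectic.nondegenerate
    h₂.symplectic.nondegenerate h₁.multiplicative h₂.multiplicative

end Smooth

/-! ### The diagonal as a smooth isotropic subgroupoid. -/

section Diagonal

variable {k : Type v} [Field k]
variable {A : Type u} [CommRing A] [Algebra k A] {B : Type u} [CommRing B] [Algebra k B]
variable {R : Type u} [CommRing R] [Algebra k R]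

lemma mem_diagonalIdeal {x : A ⊗[k] A} : x ∈ diagonalIdeal k A ↔ lmul' k x = 0 := Iff.rfl

lemma sub_mem_diagonalIdeal (a : A) : a ⊗ₜ[k] 1 - 1 ⊗ₜ[k] a ∈ diagonalIdeal k A := by
  simp [mem_diagonalIdeal]

lemma span_eq_diagonalIdeal :
    Ideal.span (Set.range fun a : A => a ⊗ₜ[k] (1 : A) - 1 ⊗ₜ[k] a) = diagonalIdeal k A := by
  apply le_antisymm
  · rw [Ideal.span_le]
    rintro _ ⟨a, rfl⟩
    exact sub_mem_diagonalIdeal a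
  · refine (KaehlerDifferential.span_range_eq_ideal k A).ge.trans ?_
    rw [Ideal.span_le]
    rintro _ ⟨a, rfl⟩
    rw [SetLike.mem_coe, ← neg_mem_iff, neg_sub]
    exact Ideal.subset_span ⟨a, rfl⟩

/-- A point of `Spec A × Spec A` lies on the diagonal if its two components agree. -/
lemma diagonalIdeal_le_ker_iff (φ : A ⊗[k] A →ₐ[k] R) :
    (∀ a ∈ diagonalIdeal k A, φ a = 0) ↔ φ.comp includeLeft = φ.comp includeRight := by
  constructor
  · intro h
    ext a
    exact sub_eq_zero.1 ((map_sub φ _ _).symm.trans (h _ (sub_mem_diagonalIdeal a)))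
  · intro h
    have : diagonalIdeal k A ≤ RingHom.ker φ := by
      rw [← span_eq_diagonalIdeal, Ideal.span_le]
      rintro _ ⟨a, rfl⟩
      exact (map_sub φ _ _).trans (sub_eq_zero.2 (DFunLike.congr_fun h a))
    exact this

lemma lmul'_map (φ : A →ₐ[k] B) (x : A ⊗[k] A) : lmul' k (map φ φ x) = φ (lmul' k x) := by
  induction x with
  | zero => simp
  | add x y hx hy => rw [map_add, map_add, hx, hy, map_add, map_add]
  | tmul a c => simp

/-- Naturality of the multiplication A ⊗ A → A. This one inclusion handles source, target, units and
inversion alike. -/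
lemma diagonalIdeal_le_comap (φ : A →ₐ[k] B) :
    diagonalIdeal k A ≤ (diagonalIdeal k B).comap (map φ φ : A ⊗[k] A →+* B ⊗[k] B) := by
  intro x hx
  rw [mem_diagonalIdeal] at hx
  rw [Ideal.mem_comap]
  change lmul' k (map φ φ x) = 0
  rw [lmul'_map, hx, map_zero]

variable (k A) in
/-- The diagonal of `Spec A × Spec A` is `Spec A`. -/
def diagonalEquiv : ((A ⊗[k] A) ⧸ diagonalIdeal k A) ≃ₐ[k] A :=
  AlgEquiv.ofBijective (Ideal.Quotient.liftₐ (diagonalIdeal k A) (lmul' k) fun _ h => h) <| by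
    constructor
    · rw [injective_iff_map_eq_zero]
      intro x hx
      obtain ⟨x, rfl⟩ := Ideal.Quotient.mk_surjective x
      exact Ideal.Quotient.eq_zero_iff_mem.2 hx
    · intro a
      exact ⟨Ideal.Quotient.mk _ (a ⊗ₜ 1), (lmul'_apply_tmul (R := k) a 1).trans (mul_one a)⟩

lemma diagonalEquiv_mk (x : A ⊗[k] A) :
    diagonalEquiv k A (Ideal.Quotient.mk _ x) = lmul' k x := rfl

/-- Under `diagonalEquiv` on both sides the induced map is `φ` itself. -/
lemma smooth_quotientMap_diagonal {φ : A →ₐ[k] B} (hφ : (φ : A →+* B).Smooth) :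
    (Ideal.quotientMap (diagonalIdeal k B) (map φ φ : A ⊗[k] A →+* B ⊗[k] B)
      (diagonalIdeal_le_comap φ)).Smooth := by
  have h : Ideal.quotientMap (diagonalIdeal k B) (map φ φ : A ⊗[k] A →+* B ⊗[k] B)
      (diagonalIdeal_le_comap φ) =
      (((diagonalEquiv k B).symm : B →+* _).comp (φ : A →+* B)).comp
        (diagonalEquiv k A : _ →+* A) := by
    apply RingHom.ext
    intro x
    obtain ⟨x, rfl⟩ := Ideal.Quotient.mk_surjective x
    rw [Ideal.quotientMap_mk]
    apply (diagonalEquiv k B).injective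
    refine (diagonalEquiv_mk _).trans ((lmul'_map φ x).trans ?_)
    exact ((diagonalEquiv k B).apply_symm_apply _).symm
  rw [h]
  exact (RingHom.Smooth.of_bijective (diagonalEquiv k A).bijective).comp
    (hφ.comp (RingHom.Smooth.of_bijective (diagonalEquiv k B).symm.bijective))

lemma smooth_diagonal [Algebra.Smooth k A] : Algebra.Smooth k ((A ⊗[k] A) ⧸ diagonalIdeal k A) :=
  Algebra.Smooth.of_equiv (diagonalEquiv k A).symm

/-- The diagonal of `G × G` is a smooth closed subgroupoid. -/
lemma AffineGroupoid.IsLie.diagonal {Γ : AffineGroupoid k A B} (h : Γ.IsLie) :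
    (Γ.prod Γ).IsSmoothClosedSubgroupoid (diagonalIdeal k B) (diagonalIdeal k A) where
  s_mem := diagonalIdeal_le_comap Γ.s
  t_mem := diagonalIdeal_le_comap Γ.t
  e_mem := diagonalIdeal_le_comap Γ.e
  inv_mem := diagonalIdeal_le_comap Γ.inv
  mul_mem := by
    intro R _ _ g l hgl hg hl
    rw [diagonalIdeal_le_ker_iff] at hg hl ⊢
    refine (compPoint_prodMul_left Γ.mul Γ.mul g l hgl).trans
      (Eq.trans ?_ (compPoint_prodMul_right Γ.mul Γ.mul g l hgl).symm)
    exact compPoint_congr Γ.mul hg hl _ _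
  smooth_base := have := h.smooth_base; smooth_diagonal
  smooth_arrows := have := h.smooth_arrows; smooth_diagonal
  smooth_s := smooth_quotientMap_diagonal h.smooth_s
  smooth_t := smooth_quotientMap_diagonal h.smooth_t

/-- The diagonal is isotropic in `G⁻ × G`. -/
lemma TwoForm.isIsotropic_diagonal (ω : TwoForm k B) :
    ((-ω).prod ω).IsIsotropic (diagonalIdeal k B) := by
  have h := (diagonalIdeal_le_ker_iff (R := (B ⊗[k] B) ⧸ diagonalIdeal k B)
    (Ideal.Quotient.mkₐ k (diagonalIdeal k B))).1 fun x hx => Ideal.Quotient.eq_zero_iff_mem.2 hx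
  -- The two projections agree on the diagonal, so the pull-backs of -ω and ω are opposite.
  rw [TwoForm.IsIsotropic, TwoForm.prod, TwoForm.pullback_add, ← TwoForm.pullback_comp,
    ← TwoForm.pullback_comp, h, TwoForm.pullback_neg, neg_add_cancel]

end Diagonal

/-! ### Tangent vectors, and the bilinear form of ω at a point. -/

section Pointwise

variable {k : Type v} [Field k] {B : Type u} [CommRing B] [Algebra k B]
  {C : Type u} [CommRing C] [Algebra k C]

section Ring

variable {K : Type u} [CommRing K] [Algebra k K]

lemma tangent_one {y : B →ₐ[k] K} (v : tangentSpace y) : v.1 1 = 0 := by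
  have := v.2 1 1
  simp only [mul_one, map_one, one_mul] at this
  simpa using this

lemma tangent_algebraMap {y : B →ₐ[k] K} (v : tangentSpace y) (c : k) :
    v.1 (algebraMap k B c) = 0 := by
  rw [Algebra.algebraMap_eq_smul_one, map_smul, tangent_one, smul_zero]

/-- The value of a vector field at a point. -/
def pointVector (y : B →ₐ[k] K) (D : Derivation k B B) : tangentSpace y :=
  ⟨y.toLinearMap ∘ₗ (D : B →ₗ[k] B), by intro f g; simp⟩

@[simp] lemma pointVector_apply (y : B →ₐ[k] K) (D : Derivation k B B) (f : B) :
    (pointVector y D).1 f = y (D f) := rfl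

/-- The tangent vector to a product with given components. -/
def prodVector (y : B ⊗[k] C →ₐ[k] K) {y₁ : B →ₐ[k] K} {y₂ : C →ₐ[k] K}
    (h₁ : y.comp includeLeft = y₁) (h₂ : y.comp includeRight = y₂)
    (v : tangentSpace y₁) (w : tangentSpace y₂) : tangentSpace y :=
  ⟨TensorProduct.lift ((LinearMap.mul k K).compl₁₂ v.1 y₂.toLinearMap +
      (LinearMap.mul k K).compl₁₂ y₁.toLinearMap w.1), by
    have hy : ∀ b c, y (b ⊗ₜ c) = y₁ b * y₂ c := by
      intro b c
      rw [← h₁, ← h₂, AlgHom.comp_apply, AlgHom.comp_apply, ← map_mul]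
      simp
    intro f g
    induction f with
    | zero => simp
    | add f f' hf hf' => simp only [add_mul, map_add, hf, hf']; ring
    | tmul b c =>
      induction g with
      | zero => simp
      | add g g' hg hg' => simp only [mul_add, map_add, hg, hg']; ring
      | tmul b' c' =>
        simp only [tmul_mul_tmul, TensorProduct.lift.tmul, LinearMap.add_apply,
          LinearMap.compl₁₂_apply, AlgHom.toLinearMap_apply, LinearMap.mul_apply', hy, v.2 b b',
          w.2 c c', map_mul]
        ring⟩

lemma prodVector_tmul (y : B ⊗[k] C →ₐ[k] K) {y₁ : B →ₐ[k] K} {y₂ : C →ₐ[k] K}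
    (h₁ : y.comp includeLeft = y₁) (h₂ : y.comp includeRight = y₂)
    (v : tangentSpace y₁) (w : tangentSpace y₂) (b : B) (c : C) :
    (prodVector y h₁ h₂ v w).1 (b ⊗ₜ c) = v.1 b * y₂ c + y₁ b * w.1 c := rfl

lemma prodVector_includeLeft (y : B ⊗[k] C →ₐ[k] K) {y₁ : B →ₐ[k] K} {y₂ : C →ₐ[k] K}
    (h₁ : y.comp includeLeft = y₁) (h₂ : y.comp includeRight = y₂)
    (v : tangentSpace y₁) (w : tangentSpace y₂) (b : B) :
    (prodVector y h₁ h₂ v w).1 ((includeLeft : B →ₐ[k] B ⊗[k] C) b) = v.1 b := by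
  rw [includeLeft_apply, prodVector_tmul, map_one, mul_one, tangent_one, mul_zero, add_zero]

lemma prodVector_includeRight (y : B ⊗[k] C →ₐ[k] K) {y₁ : B →ₐ[k] K} {y₂ : C →ₐ[k] K}
    (h₁ : y.comp includeLeft = y₁) (h₂ : y.comp includeRight = y₂)
    (v : tangentSpace y₁) (w : tangentSpace y₂) (c : C) :
    (prodVector y h₁ h₂ v w).1 ((includeRight : C →ₐ[k] B ⊗[k] C) c) = w.1 c := by
  rw [includeRight_apply, prodVector_tmul, map_one y₁, one_mul, tangent_one, zero_mul, zero_add]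

/-- A tangent vector to a product is determined by its components. -/
lemma tangent_prod_ext {y : B ⊗[k] C →ₐ[k] K} {v w : tangentSpace y}
    (h₁ : ∀ b, v.1 ((includeLeft : B →ₐ[k] B ⊗[k] C) b) =
      w.1 ((includeLeft : B →ₐ[k] B ⊗[k] C) b))
    (h₂ : ∀ c, v.1 ((includeRight : C →ₐ[k] B ⊗[k] C) c) =
      w.1 ((includeRight : C →ₐ[k] B ⊗[k] C) c)) : v = w := by
  apply Subtype.ext
  apply TensorProduct.ext'
  intro b c
  have : b ⊗ₜ[k] c = (includeLeft : B →ₐ[k] B ⊗[k] C) b *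
    (includeRight : C →ₐ[k] B ⊗[k] C) c := by simp
  rw [this, v.2, w.2, h₁, h₂]

namespace TwoForm

lemma evalAt_prod (ω : TwoForm k B) (η : TwoForm k C) (y : B ⊗[k] C →ₐ[k] K) {y₁ : B →ₐ[k] K}
    {y₂ : C →ₐ[k] K} (h₁ : y.comp includeLeft = y₁) (h₂ : y.comp includeRight = y₂)
    (v v' : tangentSpace y) (v₁ v₁' : tangentSpace y₁) (v₂ v₂' : tangentSpace y₂)
    (hv₁ : ∀ b, v₁.1 b = v.1 ((includeLeft : B →ₐ[k] B ⊗[k] C) b))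
    (hv₁' : ∀ b, v₁'.1 b = v'.1 ((includeLeft : B →ₐ[k] B ⊗[k] C) b))
    (hv₂ : ∀ c, v₂.1 c = v.1 ((includeRight : C →ₐ[k] B ⊗[k] C) c))
    (hv₂' : ∀ c, v₂'.1 c = v'.1 ((includeRight : C →ₐ[k] B ⊗[k] C) c)) :
    (ω.prod η).evalAt y v v' = ω.evalAt y₁ v₁ v₁' + η.evalAt y₂ v₂ v₂' := by
  rw [TwoForm.prod, evalAt_add, evalAt_pullback _ ω y y₁ h₁.symm v v' v₁ v₁' hv₁ hv₁',
    evalAt_pullback _ η y y₂ h₂.symm v v' v₂ v₂' hv₂ hv₂']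

lemma evalAt_swap (ω : TwoForm k B) (y : B →ₐ[k] K) (v w : tangentSpace y) :
    ω.evalAt y v w = -ω.evalAt y w v := by
  induction ω using TwoForm.induction with
  | dwedge f g => simp only [evalAt_dwedge]; ring
  | zero => simp
  | add ω η h h' => simp only [evalAt_add, h, h']; ring
  | smul c ω h => simp only [evalAt_smul, h]; ring

lemma evalAt_add_left (ω : TwoForm k B) (y : B →ₐ[k] K) (v v' w : tangentSpace y) :
    ω.evalAt y (v + v') w = ω.evalAt y v w + ω.evalAt y v' w := by
  induction ω using TwoForm.induction with
  | dwedge f g => simp only [evalAt_dwedge, Submodule.coe_add, LinearMap.add_apply]; ring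
  | zero => simp
  | add ω η h h' => simp only [evalAt_add, h, h']; ring
  | smul c ω h => simp only [evalAt_smul, h]; ring

lemma evalAt_smul_left (ω : TwoForm k B) (y : B →ₐ[k] K) (c : K) (v w : tangentSpace y) :
    ω.evalAt y (c • v) w = c * ω.evalAt y v w := by
  induction ω using TwoForm.induction with
  | dwedge f g =>
    simp only [evalAt_dwedge, Submodule.coe_smul, LinearMap.smul_apply, smul_eq_mul]; ring
  | zero => simp
  | add ω η h h' => simp only [evalAt_add, h, h']; ring
  | smul c ω h => simp only [evalAt_smul, h]; ring

/-- The bilinear form on a tangent space given by a 2-form. -/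
def bilinAt (ω : TwoForm k B) (y : B →ₐ[k] K) : LinearMap.BilinForm K (tangentSpace y) :=
  LinearMap.mk₂ K (ω.evalAt y) (evalAt_add_left ω y) (evalAt_smul_left ω y)
    (fun v w w' => by rw [evalAt_swap, evalAt_add_left, evalAt_swap ω y w,
      evalAt_swap ω y w']; ring)
    (fun c v w => by rw [evalAt_swap, evalAt_smul_left, evalAt_swap ω y w, smul_eq_mul]; ring)

@[simp] lemma bilinAt_apply (ω : TwoForm k B) (y : B →ₐ[k] K) (v w : tangentSpace y) :
    ω.bilinAt y v w = ω.evalAt y v w := rfl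

lemma bilinAt_isRefl (ω : TwoForm k B) (y : B →ₐ[k] K) : (ω.bilinAt y).IsRefl := by
  intro v w h
  rw [bilinAt_apply, evalAt_swap]
  rw [bilinAt_apply] at h
  rw [h, neg_zero]

/-- The equation ι_D ω = df at a single point. It gives pointwise nondegeneracy, and it describes
the tangent space of V(I) as the orthogonal of the Hamiltonian vectors of I. -/
lemma evalAt_pointVector (ω : TwoForm k B) (y : B →ₐ[k] K) {D : Derivation k B B} {f : B}
    (h : ω.contract D = KaehlerDifferential.D k B f) (v : tangentSpace y) :
    ω.evalAt y (pointVector y D) v = v.1 f := by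
  let _ : Algebra B K := y.toAlgebra
  have : IsScalarTower k B K := IsScalarTower.of_algebraMap_eq' y.comp_algebraMap.symm
  have hd : ∀ b, (tangentDerivation y v).liftKaehlerDifferential (KaehlerDifferential.D k B b) =
      v.1 b := Derivation.liftKaehlerDifferential_comp_D _
  have hs : ∀ (b : B) (c : K), b • c = y b * c := fun _ _ => rfl
  have key : (tangentDerivation y v).liftKaehlerDifferential (ω.contract D) =
      ω.evalAt y (pointVector y D) v := by
    clear h
    induction ω using TwoForm.induction with
    | dwedge f g =>
      simp only [contract_dwedge, map_sub, map_smul, hd, hs, evalAt_dwedge, pointVector_apply]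
    | zero => simp
    | add ω η h h' => simp only [contract_add, map_add, evalAt_add, h, h']
    | smul c ω h => simp only [contract_smul, map_smul, evalAt_smul, h, hs]
  rw [← key, h, hd]

end TwoForm

end Ring

section Field

variable {K : Type u} [Field K] [Algebra k K]

/-- A tangent vector is determined by its values on finitely many generators of the algebra. Finite
dimension is needed for double orthogonals and dimension counts. -/
instance finite_tangentSpace [hB : Algebra.FiniteType k B] (y : B →ₐ[k] K) :
    Module.Finite K (tangentSpace y) := by
  obtain ⟨s, hs⟩ := hB.out
  let F : tangentSpace y →ₗ[K] (s → K) :=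
    { toFun := fun v b => v.1 b
      map_add' := fun _ _ => rfl
      map_smul' := fun _ _ => rfl }
  refine Module.Finite.of_injective F ?_
  rw [injective_iff_map_eq_zero]
  intro v hv
  apply Subtype.ext
  ext b
  have hb : b ∈ Algebra.adjoin k (s : Set B) := hs ▸ trivial
  change v.1 b = 0
  induction hb using Algebra.adjoin_induction with
  | mem b hb => exact congrFun hv ⟨b, hb⟩
  | algebraMap c => exact tangent_algebraMap v c
  | add b c _ _ hb hc => rw [map_add, hb, hc, add_zero]
  | mul b c _ _ hb hc => rw [v.2, hb, hc, mul_zero, mul_zero, add_zero]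

namespace TwoForm

variable {ω : TwoForm k B}

/-- A vector orthogonal to the Hamiltonian vector of every function kills every function. -/
lemma IsNondegenerate.bilinAt (h : ω.IsNondegenerate) (y : B →ₐ[k] K) :
    (ω.bilinAt y).Nondegenerate := by
  have hr : ∀ v : tangentSpace y, (∀ w, ω.evalAt y w v = 0) → v = 0 := by
    intro v hv
    apply Subtype.ext
    ext f
    rw [← evalAt_pointVector ω y (h.contract_hamiltonianField f) v]
    exact hv _
  refine ⟨fun v hv => hr v fun w => ?_, fun v hv => hr v hv⟩
  rw [evalAt_swap, neg_eq_zero]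
  exact hv w

/-- At a point of a coisotropic subscheme, vectors that are orthogonal to the tangent space of the
subscheme are tangent to it. -/
lemma IsNondegenerate.tangent_of_orthogonal [Algebra.FiniteType k B] (h : ω.IsNondegenerate)
    {I : Ideal B} (hI : ω.IsCoisotropic I) (y : B →ₐ[k] K) (hy : ∀ f ∈ I, y f = 0)
    (z : tangentSpace y)
    (hz : ∀ v : tangentSpace y, (∀ f ∈ I, v.1 f = 0) → ω.evalAt y z v = 0) :
    ∀ f ∈ I, z.1 f = 0 := by
  -- The Hamiltonian vectors of elements of I. Their orthogonal consists of vectors tangent to V(I),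
  -- so `z` lies in the double orthogonal of `W`, which is `W`. Coisotropy says that `W` is itself
  -- tangent to V(I).
  let W : Submodule K (tangentSpace y) :=
    Submodule.span K ((fun f => pointVector y (ω.hamiltonianField f)) '' (I : Set B))
  have hW : ∀ v ∈ (ω.bilinAt y).orthogonal W, ∀ f ∈ I, v.1 f = 0 := by
    intro v hv f hf
    rw [← evalAt_pointVector ω y (h.contract_hamiltonianField f) v]
    exact hv _ (Submodule.subset_span ⟨f, hf, rfl⟩)
  have hzW : z ∈ W := by
    rw [← LinearMap.BilinForm.orthogonal_orthogonal (V := tangentSpace y) (K := K)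
      (h.bilinAt y) (bilinAt_isRefl ω y) W]
    intro v hv
    exact (bilinAt_isRefl ω y) _ _ (hz v (hW v hv))
  intro f hf
  clear hz
  induction hzW using Submodule.span_induction with
  | mem z hz =>
    obtain ⟨g, hg, rfl⟩ := hz
    exact hy _ (hI f hf g hg)
  | zero => rfl
  | add v w _ _ hv hw => rw [Submodule.coe_add, LinearMap.add_apply, hv, hw, add_zero]
  | smul c v _ hv => rw [Submodule.coe_smul, LinearMap.smul_apply, hv, smul_zero]

end TwoForm

end Field

end Pointwise

/-! ### Linear algebra of isotropic sections. -/

section LinearAlgebra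

variable {K V W : Type*} [Field K] [AddCommGroup V] [Module K V] [Module.Finite K V]
  [AddCommGroup W] [Module K W] {β : LinearMap.BilinForm K V}

/-- Let `P` and `Q` be projections with the same range. If the range is coisotropic and the kernel
of `Q` contains the orthogonal complement of the kernel of `P`, then the range is isotropic. -/
lemma apply_apply_eq_zero_of_orthogonal_le {P Q : V →ₗ[K] V} (hβ : β.Nondegenerate)
    (hr : β.IsRefl) (hPP : ∀ v, P (P v) = P v) (hQP : ∀ v, Q (P v) = P v)
    (hPQ : ∀ v, P (Q v) = Q v) (h₁ : ∀ z, (∀ g, β z (P g) = 0) → P z = z)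
    (h₂ : ∀ z, (∀ g, β z (P g) = β z g) → Q z = 0) (v w : V) : β (P v) (P w) = 0 := by
  have k1 : β.orthogonal (LinearMap.range P) ≤ LinearMap.range P := fun z hz =>
    ⟨z, h₁ z fun g => hr _ _ (hz _ ⟨g, rfl⟩)⟩
  have k2 : β.orthogonal (LinearMap.ker P) ≤ LinearMap.ker Q := fun z hz => by
    refine h₂ z fun g => ?_
    have : β z (P g - g) = 0 := hr _ _ (hz _ (by rw [LinearMap.mem_ker, map_sub, hPP, sub_self]))
    rwa [map_sub, sub_eq_zero] at this
  have hR : LinearMap.range Q = LinearMap.range P := by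
    apply le_antisymm
    · rintro _ ⟨g, rfl⟩
      exact ⟨Q g, hPQ g⟩
    · rintro _ ⟨g, rfl⟩
      exact ⟨P g, hQP g⟩
  -- Let n be the dimension of V and r the common rank of P and Q. The orthogonal of ker P has
  -- dimension r and ker Q has dimension n - r, so `k2` gives r ≤ n - r. As n - r is the dimension
  -- of the orthogonal of the range, the inclusion `k1` is an equality.
  have d1 := β.finrank_orthogonal hβ (LinearMap.range P)
  have d2 := β.finrank_orthogonal hβ (LinearMap.ker P)
  have d3 := LinearMap.finrank_range_add_finrank_ker P
  have d4 := LinearMap.finrank_range_add_finrank_ker Q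
  have d5 := Submodule.finrank_mono k2
  rw [hR] at d4
  have hE := Submodule.eq_of_le_of_finrank_le k1 (by omega)
  have hw : P w ∈ β.orthogonal (LinearMap.range P) := by rw [hE]; exact ⟨w, rfl⟩
  exact hw _ ⟨v, rfl⟩

/-- Functionals on an isotropic subspace are represented by vectors in any chosen complement. -/
lemma exists_apply_eq_of_isotropic_section {S : V →ₗ[K] W} {E : W →ₗ[K] V} (hβ : β.Nondegenerate)
    (hSE : ∀ w, S (E w) = w) (hE : ∀ u w, β (E u) (E w) = 0) (η : Module.Dual K W) :
    ∃ v, S v = 0 ∧ ∀ w, η w = β v (E w) := by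
  -- `v` represents η ∘ S on all of V. Subtracting E(Sv) moves it into ker S without changing its
  -- pairing with the isotropic range of E.
  let v := (β.toDual hβ).symm (η ∘ₗ S)
  have hv : ∀ u, β v u = η (S u) := LinearMap.BilinForm.apply_toDual_symm_apply (η ∘ₗ S)
  refine ⟨v - E (S v), ?_, fun w => ?_⟩
  · rw [map_sub, hSE, sub_self]
  · rw [map_sub, LinearMap.sub_apply, hv, hSE, hE, sub_zero]

end LinearAlgebra

/-! ### The tangent space at a unit and isotropy of the identity bisection. -/

namespace AffineGroupoid

section UnitPoint

variable {k : Type v} [Field k]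
variable {A : Type u} [CommRing A] [Algebra k A] {B : Type u} [CommRing B] [Algebra k B]
variable (Γ : AffineGroupoid k A B)

lemma e_s (a : A) : Γ.e (Γ.s a) = a := DFunLike.congr_fun Γ.e_comp_s a

lemma e_t (a : A) : Γ.e (Γ.t a) = a := DFunLike.congr_fun Γ.e_comp_t a

section Ring

variable {K : Type u} [CommRing K] [Algebra k K] (x : A →ₐ[k] K)

/-- The point `(1(x), 1(x), 1(x))` of `G × G × G`. -/
def unitTriple : (B ⊗[k] B) ⊗[k] B →ₐ[k] K :=
  lift (lift (x.comp Γ.e) (x.comp Γ.e) fun _ _ => Commute.all _ _) (x.comp Γ.e)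
    fun _ _ => Commute.all _ _

lemma unitTriple_comp_leg₁ : (Γ.unitTriple x).comp leg₁ = x.comp Γ.e := by
  ext b; simp [unitTriple, leg₁_apply]

lemma unitTriple_comp_leg₂ : (Γ.unitTriple x).comp leg₂ = x.comp Γ.e := by
  ext b; simp [unitTriple, leg₂_apply]

lemma unitTriple_comp_leg₃ : (Γ.unitTriple x).comp leg₃ = x.comp Γ.e :=
  lift_right _ _ _

/-- The tangent vector `(p, q, r)` at the point `(1(x), 1(x), 1(x))`. -/
def tripleVector (p q r : tangentSpace (x.comp Γ.e)) : tangentSpace (Γ.unitTriple x) :=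
  prodVector (Γ.unitTriple x) (lift_comp_includeLeft _ _ _) (lift_right _ _ _)
    (prodVector _ (lift_comp_includeLeft _ _ _) (lift_right _ _ _) p q) r

variable (p q r : tangentSpace (x.comp Γ.e)) (b : B)

lemma tripleVector_leg₁ : (Γ.tripleVector x p q r).1 (leg₁ b) = p.1 b :=
  (prodVector_includeLeft _ _ _ _ _ _).trans (prodVector_includeLeft _ _ _ _ _ _)

lemma tripleVector_leg₂ : (Γ.tripleVector x p q r).1 (leg₂ b) = q.1 b :=
  (prodVector_includeLeft _ _ _ _ _ _).trans (prodVector_includeRight _ _ _ _ _ _)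

lemma tripleVector_leg₃ : (Γ.tripleVector x p q r).1 (leg₃ b) = r.1 b :=
  prodVector_includeRight _ _ _ _ _ _

/-- A tangent vector to `G × G × G` at a unit triple is a triple of tangent vectors. -/
lemma exists_eq_tripleVector (v : tangentSpace (Γ.unitTriple x)) :
    ∃ p q r, v = Γ.tripleVector x p q r := by
  have h : ∀ (l : B →ₐ[k] (B ⊗[k] B) ⊗[k] B) (_ : (Γ.unitTriple x).comp l = x.comp Γ.e),
      v.1.comp l.toLinearMap ∈ tangentSpace (x.comp Γ.e) := fun l hl =>
    hl ▸ (tangentMap l (Γ.unitTriple x) v).2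
  refine ⟨⟨_, h leg₁ (Γ.unitTriple_comp_leg₁ x)⟩, ⟨_, h leg₂ (Γ.unitTriple_comp_leg₂ x)⟩,
    ⟨_, h leg₃ (Γ.unitTriple_comp_leg₃ x)⟩, ?_⟩
  refine tangent_prod_ext (fun m => ?_) fun b =>
    (Γ.tripleVector_leg₃ x _ _ ⟨_, h leg₃ (Γ.unitTriple_comp_leg₃ x)⟩ b).symm
  have : tangentMap includeLeft _ v =
      tangentMap includeLeft _ (Γ.tripleVector x ⟨_, h leg₁ (Γ.unitTriple_comp_leg₁ x)⟩
        ⟨_, h leg₂ (Γ.unitTriple_comp_leg₂ x)⟩ ⟨_, h leg₃ (Γ.unitTriple_comp_leg₃ x)⟩) :=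
    tangent_prod_ext
      (fun b => (Γ.tripleVector_leg₁ x ⟨_, h leg₁ (Γ.unitTriple_comp_leg₁ x)⟩ _ _ b).symm)
      fun b => (Γ.tripleVector_leg₂ x _ ⟨_, h leg₂ (Γ.unitTriple_comp_leg₂ x)⟩ _ b).symm
  exact LinearMap.congr_fun (congrArg Subtype.val this) m

lemma evalAt_tripleVector (ω : TwoForm k B) (p q r p' q' r' : tangentSpace (x.comp Γ.e)) :
    ω.triple.evalAt (Γ.unitTriple x) (Γ.tripleVector x p q r) (Γ.tripleVector x p' q' r') =
      ω.evalAt _ p p' + ω.evalAt _ q q' - ω.evalAt _ r r' := by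
  refine (TwoForm.evalAt_prod (ω.prod ω) (-ω) (Γ.unitTriple x) (lift_comp_includeLeft _ _ _)
    (lift_right _ _ _) _ _
    (prodVector _ (lift_comp_includeLeft _ _ _) (lift_right _ _ _) p q)
    (prodVector _ (lift_comp_includeLeft _ _ _) (lift_right _ _ _) p' q') r r'
    (fun b => (prodVector_includeLeft _ _ _ _ _ _).symm)
    (fun b => (prodVector_includeLeft _ _ _ _ _ _).symm)
    (fun b => (prodVector_includeRight _ _ _ _ _ _).symm)
    (fun b => (prodVector_includeRight _ _ _ _ _ _).symm)).trans ?_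
  rw [TwoForm.evalAt_prod ω ω _ (lift_comp_includeLeft _ _ _) (lift_right _ _ _) _ _ p p' q q'
      (fun b => (prodVector_includeLeft _ _ _ _ _ _).symm)
      (fun b => (prodVector_includeLeft _ _ _ _ _ _).symm)
      (fun b => (prodVector_includeRight _ _ _ _ _ _).symm)
      (fun b => (prodVector_includeRight _ _ _ _ _ _).symm),
    TwoForm.evalAt_neg, sub_eq_add_neg]

/-- The unit law at the arrow 1(x): the product of this unit with itself is itself. -/
lemma unitTriple_eq_zero : ∀ f ∈ Γ.graphIdeal, Γ.unitTriple x f = 0 := by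
  have h : Γ.graphIdeal ≤ RingHom.ker (Γ.unitTriple x) := by
    have hx : ((x.comp Γ.e).comp Γ.t).comp Γ.e = x.comp Γ.e := by
      rw [AlgHom.comp_assoc x, Γ.e_comp_t, AlgHom.comp_id]
    have hg : (((x.comp Γ.e).comp Γ.t).comp Γ.e).comp Γ.s = (x.comp Γ.e).comp Γ.t := by
      ext a; simp [e_s, e_t]
    have hgh : (x.comp Γ.e).comp Γ.s = (x.comp Γ.e).comp Γ.t := by
      ext a; simp [e_s, e_t]
    rw [graphIdeal_le_ker_iff]
    refine ⟨by rw [unitTriple_comp_leg₁, unitTriple_comp_leg₂, hgh], ?_⟩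
    rw [unitTriple_comp_leg₃]
    exact (Γ.one_comp (x.comp Γ.e) hg).symm.trans
      (compPoint_congr Γ.mul (hx.trans (Γ.unitTriple_comp_leg₁ x).symm)
        (Γ.unitTriple_comp_leg₂ x).symm _ _)
  exact h

/-- The projection `v ↦ d1(ds(v))` of the tangent space at a unit, for `σ = s`, and likewise for the
target. -/
def unitProj (σ : A →ₐ[k] B) (hσ : Γ.e.comp σ = AlgHom.id k A) :
    tangentSpace (x.comp Γ.e) →ₗ[K] tangentSpace (x.comp Γ.e) where
  toFun v := ⟨v.1.comp (σ.comp Γ.e).toLinearMap, by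
    have h : ∀ a, Γ.e (σ a) = a := DFunLike.congr_fun hσ
    intro f g
    simpa [h] using v.2 (σ (Γ.e f)) (σ (Γ.e g))⟩
  map_add' _ _ := rfl
  map_smul' _ _ := rfl

lemma unitProj_apply (σ : A →ₐ[k] B) (hσ : Γ.e.comp σ = AlgHom.id k A)
    (v : tangentSpace (x.comp Γ.e)) (b : B) : (Γ.unitProj x σ hσ v).1 b = v.1 (σ (Γ.e b)) := rfl

/-- The vectors `v` with `v = d1(ds(v))` do not depend on the choice of source or target. -/
lemma unitProj_unitProj (σ τ : A →ₐ[k] B) (hσ : Γ.e.comp σ = AlgHom.id k A)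
    (hτ : Γ.e.comp τ = AlgHom.id k A) (v : tangentSpace (x.comp Γ.e)) :
    Γ.unitProj x τ hτ (Γ.unitProj x σ hσ v) = Γ.unitProj x σ hσ v := by
  apply Subtype.ext
  ext b
  change v.1 (σ (Γ.e (τ (Γ.e b)))) = v.1 (σ (Γ.e b))
  rw [show Γ.e (τ (Γ.e b)) = Γ.e b from DFunLike.congr_fun hτ _]

/-- The vectors `(g, d1(ds(g)), g)` are tangent to the graph of multiplication. -/
lemma tripleVector_comp_one (g : tangentSpace (x.comp Γ.e)) : ∀ f ∈ Γ.graphIdeal,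
    (Γ.tripleVector x g (Γ.unitProj x Γ.s Γ.e_comp_s g) g).1 f = 0 := by
  -- Comorphism of g ↦ (g, 1(s(g)), g), which lands in the graph by the right unit law and sends
  -- 1(x) to the unit triple. The required vector is the image of `g` under its differential.
  let c : (B ⊗[k] B) ⊗[k] B →ₐ[k] B :=
    lift (lift (AlgHom.id k B) (((AlgHom.id k B).comp Γ.s).comp Γ.e) fun _ _ => Commute.all _ _)
      (AlgHom.id k B) fun _ _ => Commute.all _ _
  have h₁ : c.comp leg₁ = AlgHom.id k B := by ext b; simp [c, leg₁_apply]
  have h₂ : c.comp leg₂ = ((AlgHom.id k B).comp Γ.s).comp Γ.e := by ext b; simp [c, leg₂_apply]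
  have h₃ : c.comp leg₃ = AlgHom.id k B := lift_right _ _ _
  have hg : (AlgHom.id k B).comp Γ.s = (((AlgHom.id k B).comp Γ.s).comp Γ.e).comp Γ.t := by
    ext a; simp [e_t]
  have hc : Γ.graphIdeal ≤ RingHom.ker c := by
    rw [graphIdeal_le_ker_iff]
    refine ⟨by rw [h₁, h₂]; exact hg, ?_⟩
    rw [h₃]
    exact (Γ.comp_one (AlgHom.id k B) hg).symm.trans (compPoint_congr Γ.mul h₁.symm h₂.symm _ _)
  have hy : (x.comp Γ.e).comp c = Γ.unitTriple x := by
    apply triple_ext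
    · rw [AlgHom.comp_assoc, h₁, unitTriple_comp_leg₁, AlgHom.comp_id]
    · rw [AlgHom.comp_assoc, h₂, unitTriple_comp_leg₂]
      ext b; simp [e_s]
    · rw [AlgHom.comp_assoc, h₃, unitTriple_comp_leg₃, AlgHom.comp_id]
  obtain ⟨p, q, r, hv⟩ := Γ.exists_eq_tripleVector x
    ⟨g.1.comp c.toLinearMap, hy ▸ (tangentMap c (x.comp Γ.e) g).2⟩
  have hp : p = g := Subtype.ext <| LinearMap.ext fun b => by
    rw [← Γ.tripleVector_leg₁ x p q r, ← hv]
    exact congrArg g.1 (DFunLike.congr_fun h₁ b)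
  have hq : q = Γ.unitProj x Γ.s Γ.e_comp_s g := Subtype.ext <| LinearMap.ext fun b => by
    rw [← Γ.tripleVector_leg₂ x p q r, ← hv]
    exact congrArg g.1 (DFunLike.congr_fun h₂ b)
  have hr : r = g := Subtype.ext <| LinearMap.ext fun b => by
    rw [← Γ.tripleVector_leg₃ x p q r, ← hv]
    exact congrArg g.1 (DFunLike.congr_fun h₃ b)
  rw [hp, hq, hr] at hv
  rw [← hv]
  intro f hf
  exact (congrArg g.1 (hc hf)).trans (map_zero _)

/-- The vectors `(d1(dt(h)), h, h)` are tangent to the graph of multiplication. -/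
lemma tripleVector_one_comp (h : tangentSpace (x.comp Γ.e)) : ∀ f ∈ Γ.graphIdeal,
    (Γ.tripleVector x (Γ.unitProj x Γ.t Γ.e_comp_t h) h h).1 f = 0 := by
  -- Comorphism of h ↦ (1(t(h)), h, h), which lands in the graph by the left unit law.
  let c : (B ⊗[k] B) ⊗[k] B →ₐ[k] B :=
    lift (lift (((AlgHom.id k B).comp Γ.t).comp Γ.e) (AlgHom.id k B) fun _ _ => Commute.all _ _)
      (AlgHom.id k B) fun _ _ => Commute.all _ _
  have h₁ : c.comp leg₁ = ((AlgHom.id k B).comp Γ.t).comp Γ.e := by ext b; simp [c, leg₁_apply]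
  have h₂ : c.comp leg₂ = AlgHom.id k B := by ext b; simp [c, leg₂_apply]
  have h₃ : c.comp leg₃ = AlgHom.id k B := lift_right _ _ _
  have hg : (((AlgHom.id k B).comp Γ.t).comp Γ.e).comp Γ.s = (AlgHom.id k B).comp Γ.t := by
    ext a; simp [e_s]
  have hc : Γ.graphIdeal ≤ RingHom.ker c := by
    rw [graphIdeal_le_ker_iff]
    refine ⟨by rw [h₁, h₂]; exact hg, ?_⟩
    rw [h₃]
    exact (Γ.one_comp (AlgHom.id k B) hg).symm.trans (compPoint_congr Γ.mul h₁.symm h₂.symm _ _)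
  have hy : (x.comp Γ.e).comp c = Γ.unitTriple x := by
    apply triple_ext
    · rw [AlgHom.comp_assoc, h₁, unitTriple_comp_leg₁]
      ext b; simp [e_t]
    · rw [AlgHom.comp_assoc, h₂, unitTriple_comp_leg₂, AlgHom.comp_id]
    · rw [AlgHom.comp_assoc, h₃, unitTriple_comp_leg₃, AlgHom.comp_id]
  obtain ⟨p, q, r, hv⟩ := Γ.exists_eq_tripleVector x
    ⟨h.1.comp c.toLinearMap, hy ▸ (tangentMap c (x.comp Γ.e) h).2⟩
  have hp : p = Γ.unitProj x Γ.t Γ.e_comp_t h := Subtype.ext <| LinearMap.ext fun b => by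
    rw [← Γ.tripleVector_leg₁ x p q r, ← hv]
    exact congrArg h.1 (DFunLike.congr_fun h₁ b)
  have hq : q = h := Subtype.ext <| LinearMap.ext fun b => by
    rw [← Γ.tripleVector_leg₂ x p q r, ← hv]
    exact congrArg h.1 (DFunLike.congr_fun h₂ b)
  have hr : r = h := Subtype.ext <| LinearMap.ext fun b => by
    rw [← Γ.tripleVector_leg₃ x p q r, ← hv]
    exact congrArg h.1 (DFunLike.congr_fun h₃ b)
  rw [hp, hq, hr] at hv
  rw [← hv]
  intro f hf
  exact (congrArg h.1 (hc hf)).trans (map_zero _)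

lemma tripleVector_sub (p q r p' q' r' : tangentSpace (x.comp Γ.e)) :
    Γ.tripleVector x p q r - Γ.tripleVector x p' q' r' =
      Γ.tripleVector x (p - p') (q - q') (r - r') := by
  obtain ⟨p₀, q₀, r₀, h⟩ := Γ.exists_eq_tripleVector x
    (Γ.tripleVector x p q r - Γ.tripleVector x p' q' r')
  have hp : p - p' = p₀ := Subtype.ext <| LinearMap.ext fun b => by
    rw [← Γ.tripleVector_leg₁ x p₀ q₀ r₀, ← h, Submodule.coe_sub, Submodule.coe_sub,
      LinearMap.sub_apply, LinearMap.sub_apply, tripleVector_leg₁, tripleVector_leg₁]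
  have hq : q - q' = q₀ := Subtype.ext <| LinearMap.ext fun b => by
    rw [← Γ.tripleVector_leg₂ x p₀ q₀ r₀, ← h, Submodule.coe_sub, Submodule.coe_sub,
      LinearMap.sub_apply, LinearMap.sub_apply, tripleVector_leg₂, tripleVector_leg₂]
  have hr : r - r' = r₀ := Subtype.ext <| LinearMap.ext fun b => by
    rw [← Γ.tripleVector_leg₃ x p₀ q₀ r₀, ← h, Submodule.coe_sub, Submodule.coe_sub,
      LinearMap.sub_apply, LinearMap.sub_apply, tripleVector_leg₃, tripleVector_leg₃]
  rw [h, hp, hq, hr]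

variable {x} {p q r}

/-- Tangent vectors to the graph of multiplication have composable components. -/
lemma source_eq_target_of_tripleVector
    (h : ∀ f ∈ Γ.graphIdeal, (Γ.tripleVector x p q r).1 f = 0) (a : A) :
    p.1 (Γ.s a) = q.1 (Γ.t a) := by
  have := h _ (Γ.leg_sub_mem_graphIdeal a)
  rwa [map_sub, tripleVector_leg₁, tripleVector_leg₂, sub_eq_zero] at this

/-- The third component of a point of the graph is a function of the first two, so its variation
vanishes with theirs. -/
lemma eq_zero_of_tripleVector_zero_zero
    (h : ∀ f ∈ Γ.graphIdeal, (Γ.tripleVector x 0 0 r).1 f = 0) : r = 0 := by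
  apply Subtype.ext
  ext b
  obtain ⟨m, -, hmem⟩ := Γ.exists_leg_sub_mem_graphIdeal b
  have := h _ hmem
  rw [map_sub, tripleVector_leg₃, sub_eq_zero] at this
  rw [this]
  change (Γ.tripleVector x 0 0 r).1 (m ⊗ₜ 1) = 0
  clear this hmem
  induction m with
  | zero => simp
  | add m m' hm hm' => rw [TensorProduct.add_tmul, map_add, hm, hm', add_zero]
  | tmul a b =>
    rw [show (a ⊗ₜ[k] b) ⊗ₜ[k] (1 : B) = leg₁ a * leg₂ b by simp [leg₁_apply, leg₂_apply],
      (Γ.tripleVector x 0 0 r).2, tripleVector_leg₁, tripleVector_leg₂]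
    exact (congrArg₂ (· + ·) (mul_zero _) (mul_zero _)).trans (add_zero _)

/-- The differential of multiplication at a pair of units: `dm(g, h) = g + h - d1(ds(g))`. -/
lemma eq_of_tripleVector (h : ∀ f ∈ Γ.graphIdeal, (Γ.tripleVector x p q r).1 f = 0) :
    r = p + q - Γ.unitProj x Γ.s Γ.e_comp_s p := by
  set u := Γ.unitProj x Γ.s Γ.e_comp_s p with hu
  -- Since dt(q) = ds(p), the vector q - u is killed by dt, so (0, q - u, q - u) is tangent to the
  -- graph. Removing it and (p, u, p) from (p, q, r) leaves a vector (0, 0, ·).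
  have h' : Γ.unitProj x Γ.t Γ.e_comp_t (q - u) = 0 := by
    apply Subtype.ext
    ext b
    change (q - u).1 (Γ.t (Γ.e b)) = 0
    rw [Submodule.coe_sub, LinearMap.sub_apply, ← Γ.source_eq_target_of_tripleVector h, hu,
      unitProj_apply, e_t, sub_self]
  have h1 := Γ.tripleVector_comp_one x p
  have h2 := Γ.tripleVector_one_comp x (q - u)
  rw [h'] at h2
  rw [← hu] at h1
  have h3 : ∀ f ∈ Γ.graphIdeal, (Γ.tripleVector x 0 0 (r - p - (q - u))).1 f = 0 := by
    have e : Γ.tripleVector x 0 0 (r - p - (q - u)) =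
        Γ.tripleVector x p q r - Γ.tripleVector x p u p - Γ.tripleVector x 0 (q - u) (q - u) := by
      rw [tripleVector_sub, tripleVector_sub, show p - p - 0 = 0 by abel,
        show q - u - (q - u) = 0 by abel]
    intro f hf
    rw [e, Submodule.coe_sub, Submodule.coe_sub, LinearMap.sub_apply, LinearMap.sub_apply, h f hf,
      h1 f hf, h2 f hf, sub_zero, sub_zero]
  have h4 := Γ.eq_zero_of_tripleVector_zero_zero h3
  calc r = (r - p - (q - u)) + (p + q - u) := by abel
    _ = p + q - u := by rw [h4, zero_add]

end Ring

section Field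

variable {K : Type u} [Field K] [Algebra k K] (x : A →ₐ[k] K)
variable {Γ} {ω : TwoForm k B}

/-- Every vector tangent to the graph has the form (g, l, g + l - d1(ds(g))), so orthogonality to
all of these suffices. Letting `g` and `l` range freely, composable or not, needs only this upper
bound on the tangent space of the graph. -/
lemma IsSymplectic.tripleVector_of_orthogonal (h : Γ.IsSymplectic ω)
    {p q r : tangentSpace (x.comp Γ.e)}
    (hz : ∀ g l, ω.evalAt _ p g + ω.evalAt _ q l -
      ω.evalAt _ r (g + l - Γ.unitProj x Γ.s Γ.e_comp_s g) = 0) :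
    ∀ f ∈ Γ.graphIdeal, (Γ.tripleVector x p q r).1 f = 0 := by
  have := h.isLie.smooth_arrows
  have : Algebra.Smooth k (B ⊗[k] B) := smooth_tensorProduct
  have : Algebra.Smooth k ((B ⊗[k] B) ⊗[k] B) := smooth_tensorProduct
  have hn : ω.IsNondegenerate := h.symplectic.nondegenerate
  refine hn.triple.tangent_of_orthogonal h.multiplicative _ (Γ.unitTriple_eq_zero x) _ ?_
  intro v hv
  obtain ⟨g, l, m, rfl⟩ := Γ.exists_eq_tripleVector x v
  rw [evalAt_tripleVector, Γ.eq_of_tripleVector hv]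
  exact hz g l

/-- The identity bisection is isotropic. -/
theorem IsSymplectic.evalAt_unitProj (h : Γ.IsSymplectic ω) (v w : tangentSpace (x.comp Γ.e)) :
    ω.evalAt _ (Γ.unitProj x Γ.s Γ.e_comp_s v) (Γ.unitProj x Γ.s Γ.e_comp_s w) = 0 := by
  have := h.isLie.smooth_arrows
  have hn : ω.IsNondegenerate := h.symplectic.nondegenerate
  have hadd : ∀ a b c, ω.bilinAt (x.comp Γ.e) a (b + c) =
    ω.bilinAt (x.comp Γ.e) a b + ω.bilinAt (x.comp Γ.e) a c := fun a b c => map_add _ b c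
  have hsub : ∀ a b c, ω.bilinAt (x.comp Γ.e) a (b - c) =
    ω.bilinAt (x.comp Γ.e) a b - ω.bilinAt (x.comp Γ.e) a c := fun a b c =>
      map_sub (ω.bilinAt (x.comp Γ.e) a) b c
  refine apply_apply_eq_zero_of_orthogonal_le (β := ω.bilinAt (x.comp Γ.e))
    (P := Γ.unitProj x Γ.s Γ.e_comp_s) (Q := Γ.unitProj x Γ.t Γ.e_comp_t) (hn.bilinAt _)
    (TwoForm.bilinAt_isRefl ω _) (Γ.unitProj_unitProj x _ _ _ _) (Γ.unitProj_unitProj x _ _ _ _)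
    (Γ.unitProj_unitProj x _ _ _ _) (fun z hz => ?_) (fun z hz => ?_) v w
  -- (z, z, z) pairs with (g, l, g + l - Pg) to ω(z, Pg) = 0. So it is tangent to the graph, and z =
  -- z + z - Pz.
  · have := Γ.eq_of_tripleVector (h.tripleVector_of_orthogonal x (p := z) (q := z) (r := z)
      fun g l => by
        simp only [← TwoForm.bilinAt_apply]
        rw [hsub, hadd, hz]; ring)
    exact add_left_cancel (eq_sub_iff_add_eq.1 this)
  -- (0, z, z) pairs with (g, l, g + l - Pg) to ω(z, Pg) - ω(z, g) = 0. So it is tangent to the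
  -- graph, and composability gives dt(z) = ds(0) = 0.
  · have := Γ.source_eq_target_of_tripleVector
      (h.tripleVector_of_orthogonal x (p := 0) (q := z) (r := z) fun g l => by
        simp only [← TwoForm.bilinAt_apply]
        rw [hsub, hadd, hz, map_zero, LinearMap.zero_apply]; ring)
    exact Subtype.ext <| LinearMap.ext fun b => (this (Γ.e b)).symm

/-- The differential of the source morphism at a unit. -/
def sourceMap : tangentSpace (x.comp Γ.e) →ₗ[K] tangentSpace x where
  toFun v := ⟨v.1.comp Γ.s.toLinearMap, by
    have h : ∀ a, Γ.e (Γ.s a) = a := Γ.e_s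
    intro f g
    simpa [h] using v.2 (Γ.s f) (Γ.s g)⟩
  map_add' _ _ := rfl
  map_smul' _ _ := rfl

/-- The Lie algebroid of a symplectic groupoid is the cotangent bundle of the base. -/
theorem IsSymplectic.exists_algebroid_vector (h : Γ.IsSymplectic ω)
    (η : Module.Dual K (tangentSpace x)) :
    ∃ v : tangentSpace (x.comp Γ.e), tangentMap Γ.s (x.comp Γ.e) v = 0 ∧
      ∀ w : tangentSpace x, η w = ω.evalAt (x.comp Γ.e) v (tangentMap Γ.e x w) := by
  have := h.isLie.smooth_arrows
  have hn : ω.IsNondegenerate := h.symplectic.nondegenerate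
  have hP : ∀ w, tangentMap Γ.e x w = Γ.unitProj x Γ.s Γ.e_comp_s (tangentMap Γ.e x w) :=
    fun w => Subtype.ext <| LinearMap.ext fun b => (congrArg w.1 (Γ.e_s (Γ.e b))).symm
  -- `sourceMap` takes values in the tangent space at `x` itself; `tangentMap Γ.s` would land at a
  -- point equal to `x` only propositionally.
  have hS : ∀ w, sourceMap (Γ := Γ) x (tangentMap Γ.e x w) = w :=
    fun w => Subtype.ext <| LinearMap.ext fun a => congrArg w.1 (Γ.e_s a)
  have hE : ∀ u w, ω.bilinAt (x.comp Γ.e) (tangentMap Γ.e x u) (tangentMap Γ.e x w) = 0 := by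
    intro u w
    rw [hP u, hP w]
    exact h.evalAt_unitProj x _ _
  obtain ⟨v, hv, hv'⟩ := exists_apply_eq_of_isotropic_section (K := K)
    (V := tangentSpace (x.comp Γ.e)) (W := tangentSpace x) (hn.bilinAt (x.comp Γ.e)) hS hE η
  exact ⟨v, Subtype.ext <| LinearMap.ext fun a => LinearMap.congr_fun (congrArg Subtype.val hv) a,
    hv'⟩

end Field

end UnitPoint

end AffineGroupoid

/-! ### The Lie algebroid of the diagonal. -/

section DiagonalStabilizer

variable {k : Type v} [Field k]
variable {A : Type u} [CommRing A] [Algebra k A] {B : Type u} [CommRing B] [Algebra k B]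

namespace TwoForm

variable {ω : TwoForm k B}

lemma IsNondegenerate.bracket_sub_right (h : ω.IsNondegenerate) (f g l : B) :
    ω.bracket f (g - l) = ω.bracket f g - ω.bracket f l := by
  rw [h.bracket_swap, TwoForm.bracket, map_sub, neg_sub, h.bracket_swap f g, h.bracket_swap f l]
  simp only [TwoForm.bracket]
  ring

lemma bracket_sub_left (f g l : B) : ω.bracket (f - g) l = ω.bracket f l - ω.bracket g l :=
  map_sub _ _ _

/-- The diagonal is coisotropic in `G⁻ × G`. -/
lemma IsNondegenerate.isCoisotropic_diagonal (h : ω.IsNondegenerate) :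
    ((-ω).prod ω).IsCoisotropic (diagonalIdeal k B) := by
  have hP := h.neg.prod h
  rw [← span_eq_diagonalIdeal]
  refine hP.isCoisotropic_span ?_
  rintro _ ⟨a, rfl⟩ _ ⟨b, rfl⟩
  have hLL := bracket_includeLeft h.neg h a b
  have hLR := bracket_includeLeft_includeRight h.neg h a b
  have hRL := bracket_includeLeft_includeRight h.neg h b a
  have hRR := bracket_includeRight h.neg h a b
  simp only [includeLeft_apply, includeRight_apply, h.bracket_neg] at hLL hLR hRL hRR
  -- The mixed brackets vanish and the first factor carries -ω, so the bracket of the generators of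
  -- `a` and `b` is minus the generator of {a, b}.
  rw [bracket_sub_left, hP.bracket_sub_right, hP.bracket_sub_right, hLL, hLR, hRR,
    hP.bracket_swap (1 ⊗ₜ a), hRL, neg_zero, sub_zero, zero_sub, TensorProduct.neg_tmul,
    sub_neg_eq_add, ← neg_mem_iff, neg_add, neg_neg, ← sub_eq_add_neg]
  exact Ideal.subset_span ⟨ω.bracket a b, rfl⟩

/-- A vector tangent to the diagonal has equal components, so the contributions of -ω and ω cancel.
-/
lemma evalAt_diagonal_eq_zero {K : Type u} [CommRing K] [Algebra k K] (ω : TwoForm k B)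
    (y : B ⊗[k] B →ₐ[k] K) (hy : y.comp includeLeft = y.comp includeRight) (v v' : tangentSpace y)
    (hv : ∀ b ∈ diagonalIdeal k B, v.1 b = 0) (hv' : ∀ b ∈ diagonalIdeal k B, v'.1 b = 0) :
    ((-ω).prod ω).evalAt y v v' = 0 := by
  have hR : ∀ (u : tangentSpace y), (∀ b ∈ diagonalIdeal k B, u.1 b = 0) → ∀ b,
      (tangentMap includeLeft y u).1 b = u.1 ((includeRight : B →ₐ[k] B ⊗[k] B) b) :=
    fun u hu b => sub_eq_zero.1 ((map_sub u.1 _ _).symm.trans (hu _ (sub_mem_diagonalIdeal b)))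
  rw [evalAt_prod (-ω) ω y rfl hy.symm v v' (tangentMap includeLeft y v)
      (tangentMap includeLeft y v') (tangentMap includeLeft y v) (tangentMap includeLeft y v')
      (fun _ => rfl) (fun _ => rfl) (hR v hv) (hR v' hv'), evalAt_neg, neg_add_cancel]

end TwoForm

namespace AffineGroupoid

variable {Γ : AffineGroupoid k A B} {ω : TwoForm k B}

/-- Conormal covectors to the diagonal are mapped by the anchor to vectors along the diagonal. -/
lemma anchorTangent_diagonal (hω : ω.IsNondegenerate) {K : Type u} [CommRing K] [Algebra k K]
    (x : A ⊗[k] A →ₐ[k] K) (hx : ∀ f ∈ diagonalIdeal k A, x f = 0)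
    {ξ : Module.Dual K (tangentSpace x)} (hξ : IsConormal (diagonalIdeal k A) x ξ) :
    (Γ.prod Γ).AnchorTangent ((-ω).prod ω) (diagonalIdeal k A) x ξ := by
  intro f hf
  -- It suffices that the base field of `f` is tangent to ΔX, that is, that {g, f} = 1^*{t^*g, t^*f}
  -- vanishes there for `g` in the ideal. Both t^* and 1^* respect the diagonal ideals, and ΔG is
  -- coisotropic.
  apply hξ
  intro g hg
  rw [baseField_apply]
  refine hx _ (diagonalIdeal_le_comap Γ.e ?_)
  exact hω.isCoisotropic_diagonal _ (diagonalIdeal_le_comap Γ.t hg) _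
    (diagonalIdeal_le_comap Γ.t hf)

variable {K : Type u} [Field K] [Algebra k K]

/-- Conormal covectors to the diagonal of the base lie in the Lie algebroid of the diagonal. -/
lemma IsSymplectic.inLieAlgebroid_diagonal (h : Γ.IsSymplectic ω) {x : A ⊗[k] A →ₐ[k] K}
    {x₀ : A →ₐ[k] K} (hx : x = x₀.comp (lmul' k)) {ξ : Module.Dual K (tangentSpace x)}
    (hξ : IsConormal (diagonalIdeal k A) x ξ) :
    (Γ.prod Γ).InLieAlgebroid ((-ω).prod ω) (diagonalIdeal k B) x ξ := by
  have hL : x.comp includeLeft = x₀ := by ext a; simp [hx]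
  have hR : x.comp includeRight = x₀ := by ext a; simp [hx]
  have hyL : (x.comp (Γ.prod Γ).e).comp includeLeft = x₀.comp Γ.e := by
    rw [← hL]; exact comp_map_left x Γ.e Γ.e
  have hyR : (x.comp (Γ.prod Γ).e).comp includeRight = x₀.comp Γ.e := by
    rw [← hR]; exact comp_map_right x Γ.e Γ.e
  have hy : x.comp (Γ.prod Γ).e = (x₀.comp Γ.e).comp (lmul' k) := by
    apply tensor_ext
    · rw [hyL]; ext b; simp
    · rw [hyR]; ext b; simp
  -- The restriction of ξ to vectors (0, u), which determines ξ since ξ vanishes on vectors (u, u).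
  let η : Module.Dual K (tangentSpace x₀) :=
    { toFun := fun u => ξ (prodVector x hL hR 0 u)
      map_add' := fun u u' => by
        rw [← map_add]
        refine congrArg ξ (tangent_prod_ext (fun b => ?_) fun b => ?_)
        · rw [Submodule.coe_add, LinearMap.add_apply, prodVector_includeLeft,
            prodVector_includeLeft, prodVector_includeLeft]
          exact (add_zero _).symm
        · rw [Submodule.coe_add, LinearMap.add_apply, prodVector_includeRight,
            prodVector_includeRight, prodVector_includeRight]
          rfl
      map_smul' := fun c u => by
        rw [RingHom.id_apply, ← map_smul]
        refine congrArg ξ (tangent_prod_ext (fun b => ?_) fun b => ?_)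
        · rw [Submodule.coe_smul, LinearMap.smul_apply, prodVector_includeLeft,
            prodVector_includeLeft]
          exact (smul_zero _).symm
        · rw [Submodule.coe_smul, LinearMap.smul_apply, prodVector_includeRight,
            prodVector_includeRight]
          rfl }
  obtain ⟨v₀, hv₀, hη⟩ := h.exists_algebroid_vector x₀ η
  -- The witness is (v₀, v₀), the image of v₀ under the differential of the diagonal embedding.
  refine ⟨⟨v₀.1.comp (lmul' k : B ⊗[k] B →ₐ[k] B).toLinearMap,
    hy ▸ (tangentMap (lmul' k) (x₀.comp Γ.e) v₀).2⟩, ?_, fun b hb => ?_, fun w => ?_⟩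
  · apply Subtype.ext
    apply LinearMap.ext
    intro a
    exact (congrArg v₀.1 (lmul'_map Γ.s a)).trans
      (LinearMap.congr_fun (congrArg Subtype.val hv₀) (lmul' k a))
  · exact (congrArg v₀.1 hb).trans (map_zero _)
  · obtain ⟨w₁, hw₁⟩ : ∃ w₁ : tangentSpace x₀, ∀ a, w₁.1 a = w.1 (a ⊗ₜ 1) :=
      ⟨⟨w.1.comp (includeLeft : A →ₐ[k] A ⊗[k] A).toLinearMap,
        hL ▸ (tangentMap includeLeft x w).2⟩, fun _ => rfl⟩
    obtain ⟨w₂, hw₂⟩ : ∃ w₂ : tangentSpace x₀, ∀ a, w₂.1 a = w.1 (1 ⊗ₜ a) :=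
      ⟨⟨w.1.comp (includeRight : A →ₐ[k] A ⊗[k] A).toLinearMap,
        hR ▸ (tangentMap includeRight x w).2⟩, fun _ => rfl⟩
    obtain ⟨d, hd⟩ : ∃ d : tangentSpace x, ∀ a, d.1 a = w₁.1 (lmul' k a) :=
      ⟨⟨w₁.1.comp (lmul' k : A ⊗[k] A →ₐ[k] A).toLinearMap, by
        rw [hx]; exact (tangentMap (lmul' k) x₀ w₁).2⟩, fun _ => rfl⟩
    have hdiag : ξ d = 0 := hξ _ fun f hf => by
      rw [hd, mem_diagonalIdeal.1 hf, map_zero]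
    -- (w₁, w₂) + (0, w₁) = (w₁, w₁) + (0, w₂), whence ξ(w) = η(w₂) - η(w₁). This is the value of -ω
    -- ⊕ ω on (v₀, v₀) and the image of w under d1.
    have hsum : w + prodVector x hL hR 0 w₁ = d + prodVector x hL hR 0 w₂ := by
      refine tangent_prod_ext (fun a => ?_) fun a => ?_
      · rw [Submodule.coe_add, Submodule.coe_add, LinearMap.add_apply, LinearMap.add_apply,
          prodVector_includeLeft, prodVector_includeLeft, hd, includeLeft_apply, lmul'_apply_tmul,
          mul_one, hw₁]
      · rw [Submodule.coe_add, Submodule.coe_add, LinearMap.add_apply, LinearMap.add_apply,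
          prodVector_includeRight, prodVector_includeRight, hd, includeRight_apply,
          lmul'_apply_tmul, one_mul, hw₂, add_comm]
    have hξw : ξ w + η w₁ = η w₂ := by
      have := congrArg ξ hsum
      rwa [map_add, map_add, hdiag, zero_add] at this
    rw [TwoForm.evalAt_prod (-ω) ω _ hyL hyR _ _ v₀ (tangentMap Γ.e x₀ w₁) v₀
      (tangentMap Γ.e x₀ w₂) (fun b => ?_) (fun b => ?_) (fun b => ?_) (fun b => ?_),
      TwoForm.evalAt_neg, ← hη, ← hη, ← hξw]
    · ring
    · exact congrArg v₀.1 ((lmul'_apply_tmul (R := k) b 1).trans (mul_one b)).symm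
    · exact (hw₁ _).trans (congrArg w.1 (congrArg (fun c => Γ.e b ⊗ₜ[k] c) (map_one Γ.e)).symm)
    · exact congrArg v₀.1 ((lmul'_apply_tmul (R := k) 1 b).trans (one_mul b)).symm
    · exact (hw₂ _).trans (congrArg w.1 (congrArg (fun c => c ⊗ₜ[k] Γ.e b) (map_one Γ.e)).symm)

/-- The diagonal is a stabilizer subgroupoid of `G⁻ × G`. -/
theorem IsSymplectic.isStabilizerSubgroupoid_diagonal (h : Γ.IsSymplectic ω) :
    (Γ.prod Γ).IsStabilizerSubgroupoid ((-ω).prod ω) (diagonalIdeal k B) (diagonalIdeal k A) where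
  subgroupoid := h.isLie.diagonal
  isotropic := ω.isIsotropic_diagonal
  lieAlgebroid := by
    intro K _ _ x hx ξ
    constructor
    · rintro ⟨v, -, hv, hξ⟩
      -- For w tangent to ΔX, both v and d1(w) are tangent to ΔG, which is isotropic.
      have hc : IsConormal (diagonalIdeal k A) x ξ := by
        intro w hw
        rw [hξ w]
        refine TwoForm.evalAt_diagonal_eq_zero ω _ ?_ _ _ hv fun b hb =>
          hw _ (diagonalIdeal_le_comap Γ.e hb)
        rw [← diagonalIdeal_le_ker_iff]
        exact fun b hb => hx _ (diagonalIdeal_le_comap Γ.e hb)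
      exact ⟨hc, anchorTangent_diagonal h.symplectic.nondegenerate x hx hc⟩
    · rintro ⟨hc, -⟩
      obtain ⟨x₀, hx₀⟩ : ∃ x₀ : A →ₐ[k] K, x = x₀.comp (lmul' k) := by
        have hLR := (diagonalIdeal_le_ker_iff x).1 hx
        refine ⟨x.comp includeLeft, tensor_ext ?_ ?_⟩
        · ext a; simp
        · rw [← hLR]; ext a; simp
      exact h.inLieAlgebroid_diagonal hx₀ hc

end AffineGroupoid

end DiagonalStabilizer

end AffSympl

end

theorem mainTheorem4 {𝕜 : Type v} [RCLike 𝕜] {A B : Type u}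
    [CommRing A] [Algebra 𝕜 A] [CommRing B] [Algebra 𝕜 B]
    (Γ : AffSympl.AffineGroupoid 𝕜 A B) (ω : AffSympl.TwoForm 𝕜 B) (hΓ : Γ.IsSymplectic ω) :
    (Γ.prod Γ).IsSymplectic ((-ω).prod ω) ∧
      (Γ.prod Γ).IsStabilizerSubgroupoid ((-ω).prod ω)
        (AffSympl.diagonalIdeal 𝕜 B) (AffSympl.diagonalIdeal 𝕜 A) :=
  ⟨hΓ.prod hΓ, hΓ.isStabilizerSubgroupoid_diagonal⟩
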